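/- **Theorem (Trace distance estimation for pure quantum states).** For $N=2^n$ and density operators $\rho,\sigma$ on $\mathbb{C}^N$ let $T(\rho,\sigma)=\tfrac12\operatorname{tr}|\rho-\sigma|$, and for unit vectors $|\psi\rangle,|\phi\rangle\in\mathbb{C}^N$ write $T(|\psi\rangle,|\phi\rangle)=T(|\psi\rangle\langle\psi|,|\phi\rangle\langle\phi|)$. A quantum algorithm runs a circuit of elementary gates (unitaries on at most two qubits) and, where oracles are given, queries (uses of an oracle, its inverse, or a controlled version of either), then measures all qubits in the computational basis and outputs a real number that is a function of the outcome. Its query complexity is the number of queries; its sample complexity is the number of copies of the input states it uses; its time complexity is the number of queries (or samples) plus the number of elementary gates; its depth is the maximal length of a path through its circuit, each gate or query having length $1$. The circuit and the output function depend only on $n$, the numbers of oracle ancilla qubits (for purified access), $\varepsilon$ and $\eta$ below, not on the states or the oracles. 1. For all unit vectors $|\psi\rangle,|\phi\rangle\in\mathbb{C}^N$, $T(|\psi\rangle,|\phi\rangle)=\sqrt{1-|\langle\psi|\phi\rangle|^2}$. 2. (Purified access.) For every $\eta>0$ there is a constant $C>0$ such that for all $n\ge 0$, all $n_\psi,n_\phi\le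 n$ and all $\varepsilon>0$ there is a quantum algorithm with query complexity at most $C/\varepsilon^2$ and time complexity at most $C\log(N)/\varepsilon^2$ with the following property. For all unit vectors $|\psi\rangle,|\phi\rangle\in\mathbb{C}^N$, given as oracles any unitaries $U_\psi$ and $U_\phi$, on $n+n_\psi$ and $n+n_\phi$ qubits, that prepare purifications of $|\psi\rangle\langle\psi|$ and $|\phi\rangle\langle\phi|$ (that is, $\operatorname{tr}_{n_\psi}\bigl(U_\psi|0\rangle\langle 0|U_\psi^\dagger\bigr)=|\psi\rangle\langle\psi|$, and likewise for $\phi$; for $n_\psi=0$ this says $U_\psi|0\rangle=|\psi\rangle$ up to a phase), it outputs, with probability at least $1-\eta$, a number $\widetilde T$ with $|\widetilde T-T(|\psi\rangle,|\phi\rangle)|\le\varepsilon$. 3. (Sample access.) For every $\eta>0$ there is a constant $C>0$ such that for all $n\ge 0$ and all $\varepsilon>0$ there is a quantum algorithm without oracles, with sample complexity at most $C/\varepsilon^4$, time complexity at most $C\log(N)/\varepsilon^4$ and depth at most $C$, with the following property. For all unit vectors $|\psi\rangle,|\phi\rangle\in\mathbb{C}^N$, given as input copies of $|\psi\rangle$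 and $|\phi\rangle$ together with workspace qubits in the state $|0\rangle$, it outputs, with probability at least $1-\eta$, a number $\widetilde T$ with $|\widetilde T-T(|\psi\rangle,|\phi\rangle)|\le\varepsilon$. -/

import Mathlib

open scoped MatrixOrder ComplexOrder Matrix

noncomputable section

namespace TraceDist

/-! ### States and trace distance -/

/-- Computational basis labels of a register whose qubits are indexed by `ι`. -/
abbrev Bits (ι : Type) : Type := ι → Bool

/-- Vectors of the Hilbert space `ℂ^N`, `N = 2 ^ n`, of an `n`-qubit register. -/
abbrev QVec (n : ℕ) : Type := EuclideanSpace ℂ (Bits (Fin n))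

/-- The rank-one operator `|ψ⟩⟨ψ|`. -/
def pureState {n : ℕ} (ψ : QVec n) : Matrix (Bits (Fin n)) (Bits (Fin n)) ℂ :=
  Matrix.vecMulVec (fun x => ψ x) (fun y => star (ψ y))

/-- The trace distance `T(ρ, σ) = (1/2) tr |ρ - σ|`, where `|A| = √(A† A)`. -/
def traceDistance {d : Type} [Fintype d] [DecidableEq d] (ρ σ : Matrix d d ℂ) : ℝ :=
  (1 / 2 : ℝ) * (Matrix.trace (CFC.abs (ρ - σ))).re

/-- The basis vector `|0 … 0⟩`. -/
def zeroKet (ι : Type) [Fintype ι] : Bits ι → ℂ :=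
  fun x => if x = (fun _ => false) then 1 else 0

/-- The partial trace over the second (ancilla) register. -/
def traceOutAncilla {ι κ : Type} [Fintype κ] [DecidableEq κ]
    (M : Matrix (Bits (ι ⊕ κ)) (Bits (ι ⊕ κ)) ℂ) : Matrix (Bits ι) (Bits ι) ℂ :=
  fun x y => ∑ z : Bits κ, M (Sum.elim x z) (Sum.elim y z)

/-- `U` prepares a purification of the `n`-qubit state `ρ`, with `a` ancilla qubits: tracing the
ancilla out of the pure state `U |0⟩` gives `ρ`. -/
def PreparesPurification {n a : ℕ} (U : Matrix.unitaryGroup (Bits (Fin n ⊕ Fin a)) ℂ)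
    (ρ : Matrix (Bits (Fin n)) (Bits (Fin n)) ℂ) : Prop :=
  traceOutAncilla
    (Matrix.vecMulVec (U.1 *ᵥ zeroKet (Fin n ⊕ Fin a))
      (star (U.1 *ᵥ zeroKet (Fin n ⊕ Fin a)))) = ρ

/-! ### Circuits -/

open Classical in
/-- The operator on the register `ι` that applies `U` to the wires selected by `e` and the
identity to all other wires. -/
def onWires {ι κ : Type} (e : κ ↪ ι) (U : Matrix (Bits κ) (Bits κ) ℂ) :
    Matrix (Bits ι) (Bits ι) ℂ :=
  fun x y => if ∀ i, i ∉ Set.range e → x i = y i then U (x ∘ e) (y ∘ e) else 0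

/-- The controlled version of `U`; the control qubit is the wire `none`. -/
def controlled {κ : Type} [Fintype κ] [DecidableEq κ] (U : Matrix (Bits κ) (Bits κ) ℂ) :
    Matrix (Bits (Option κ)) (Bits (Option κ)) ℂ :=
  fun x y =>
    if x none = y none then
      if x none = true then U (x ∘ some) (y ∘ some)
      else (1 : Matrix (Bits κ) (Bits κ) ℂ) (x ∘ some) (y ∘ some)
    else 0

/-- One step of a circuit on the wires `ι`, with oracles indexed by `Q`, where the oracle `q` acts
on a register indexed by `κ q`: an elementary gate (an arbitrary unitary on at most two qubits),
a query to the oracle or its inverse, or a query to the controlled oracle or its inverse. -/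
inductive Step (ι Q : Type) (κ : Q → Type) : Type
  | gate (k : ℕ) (hk : k ≤ 2) (u : Matrix.unitaryGroup (Bits (Fin k)) ℂ) (e : Fin k ↪ ι)
  | query (q : Q) (inverse : Bool) (e : κ q ↪ ι)
  | controlledQuery (q : Q) (inverse : Bool) (e : Option (κ q) ↪ ι)

namespace Step

variable {ι Q : Type} {κ : Q → Type}

/-- The wires on which a step acts. -/
def wires : Step ι Q κ → Set ι
  | gate _ _ _ e => Set.range e
  | query _ _ e => Set.range e
  | controlledQuery _ _ e => Set.range e

/-- Whether a step is a query. -/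
def isQuery : Step ι Q κ → Bool
  | gate _ _ _ _ => false
  | query _ _ _ => true
  | controlledQuery _ _ _ => true

/-- The operator applied by a step when the oracles are `O`. -/
def matrix [∀ q, Fintype (κ q)] [∀ q, DecidableEq (κ q)]
    (O : ∀ q, Matrix.unitaryGroup (Bits (κ q)) ℂ) : Step ι Q κ → Matrix (Bits ι) (Bits ι) ℂ
  | gate _ _ u e => onWires e u.1
  | query q inverse e => onWires e (if inverse then (O q).1ᴴ else (O q).1)
  | controlledQuery q inverse e =>
      onWires e (controlled (if inverse then (O q).1ᴴ else (O q).1))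

end Step

/-- A circuit is a finite list of steps, applied from left to right. -/
abbrev Circuit (ι Q : Type) (κ : Q → Type) : Type := List (Step ι Q κ)

namespace Circuit

variable {ι Q : Type} {κ : Q → Type}

/-- The state obtained from `v` by running the circuit with the oracles `O`. -/
def run [Fintype ι] [DecidableEq ι] [∀ q, Fintype (κ q)] [∀ q, DecidableEq (κ q)]
    (O : ∀ q, Matrix.unitaryGroup (Bits (κ q)) ℂ) (c : Circuit ι Q κ) (v : Bits ι → ℂ) :
    Bits ι → ℂ :=
  List.foldl (fun w g => g.matrix O *ᵥ w) v c

/-- The number of queries. -/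
def queryCount (c : Circuit ι Q κ) : ℕ := List.countP Step.isQuery c

/-- The number of queries and elementary gates. -/
def size (c : Circuit ι Q κ) : ℕ := List.length c

/-- The depth: the maximal length of a path through the circuit, that is, of a sequence of steps
of the circuit, in their order, in which any two consecutive ones share a wire.
Every step has unit length. -/
def depth (c : Circuit ι Q κ) : ℕ :=
  sSup {d | ∃ p : List (Step ι Q κ), List.Sublist p c ∧
    List.IsChain (fun g h => (g.wires ∩ h.wires).Nonempty) p ∧ p.length = d}

end Circuit

/-- Probability that measuring the unit vector `v` in the computational basis, and applying `out`
to the outcome, gives a number at distance at most `ε` from `t`. -/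
def probWithin {ι : Type} [Fintype ι] [DecidableEq ι] (v : Bits ι → ℂ) (out : Bits ι → ℝ)
    (t ε : ℝ) : ℝ :=
  ∑ x : Bits ι, if |out x - t| ≤ ε then ‖v x‖ ^ 2 else 0

/-! ### Algorithms with purified access -/

/-- An algorithm with query access to two oracles, where oracle `i` acts on `n` system qubits and
`anc i` ancilla qubits. It runs a circuit on `|0 … 0⟩`, measures all qubits in the computational
basis, and outputs a function of the outcome. -/
structure QueryAlgorithm (n : ℕ) (anc : Fin 2 → ℕ) where
  width : ℕ
  circuit : Circuit (Fin width) (Fin 2) (fun i => Fin n ⊕ Fin (anc i))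
  output : Bits (Fin width) → ℝ

namespace QueryAlgorithm

variable {n : ℕ} {anc : Fin 2 → ℕ}

def queryComplexity (A : QueryAlgorithm n anc) : ℕ := A.circuit.queryCount

/-- Number of queries and elementary gates. -/
def timeComplexity (A : QueryAlgorithm n anc) : ℕ := A.circuit.size

/-- Probability that the output is within `ε` of `t`, when the oracles are `U`. -/
def successProb (A : QueryAlgorithm n anc)
    (U : ∀ i, Matrix.unitaryGroup (Bits (Fin n ⊕ Fin (anc i))) ℂ) (t ε : ℝ) : ℝ :=
  probWithin (A.circuit.run U (zeroKet (Fin A.width))) A.output t ε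

end QueryAlgorithm

/-! ### Algorithms with sample access -/

/-- The wires of an algorithm that uses `s` copies of one `n`-qubit state, `t` copies of
another one, and `w` workspace qubits. -/
abbrev SampleWires (n s t w : ℕ) : Type := ((Fin s × Fin n) ⊕ (Fin t × Fin n)) ⊕ Fin w

/-- The state `|ψ⟩^{⊗ s} ⊗ |φ⟩^{⊗ t} ⊗ |0⟩^{⊗ w}`. -/
def copies {n : ℕ} (s t w : ℕ) (ψ φ : QVec n) : Bits (SampleWires n s t w) → ℂ :=
  fun x =>
    (∏ i : Fin s, ψ (fun j => x (Sum.inl (Sum.inl (i, j))))) *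
    (∏ i : Fin t, φ (fun j => x (Sum.inl (Sum.inr (i, j))))) *
    zeroKet (Fin w) (fun j => x (Sum.inr j))

/-- An algorithm with access to copies of two `n`-qubit states. It runs an oracle-free circuit on
the copies and on workspace qubits in the state `|0⟩`, measures all qubits in the computational
basis, and outputs a function of the outcome. -/
structure SampleAlgorithm (n : ℕ) where
  copies₁ : ℕ
  copies₂ : ℕ
  workspace : ℕ
  circuit : Circuit (SampleWires n copies₁ copies₂ workspace) Empty (fun _ => Empty)
  output : Bits (SampleWires n copies₁ copies₂ workspace) → ℝ

namespace SampleAlgorithm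

variable {n : ℕ}

/-- Total number of copies of both states. -/
def sampleComplexity (A : SampleAlgorithm n) : ℕ := A.copies₁ + A.copies₂

/-- Number of samples and elementary gates. -/
def timeComplexity (A : SampleAlgorithm n) : ℕ := A.sampleComplexity + A.circuit.size

def depthComplexity (A : SampleAlgorithm n) : ℕ := A.circuit.depth

/-- Probability that the output is within `ε` of `t`, on copies of `ψ` and `φ`. -/
def successProb (A : SampleAlgorithm n) (ψ φ : QVec n) (t ε : ℝ) : ℝ :=
  probWithin (A.circuit.run (fun q => q.elim) (copies A.copies₁ A.copies₂ A.workspace ψ φ))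
    A.output t ε

end SampleAlgorithm

end TraceDist

end

noncomputable section

namespace TraceDist

/-! ### The trace distance of pure states -/

/-! For pure states the difference `A` of the two projectors satisfies `A³ = t² A` with `t² = 1 -
|⟨ψ|φ⟩|²`, which gives `T = t` (`trace_abs_sub`). Estimating `T` is therefore estimating an overlap,
and the destructive swap test does this: a Bell measurement on each pair of corresponding qubits,
where the product of the signs (-1 for a singlet, +1 otherwise) has mean equal to the expectation of
the exchange operator, `|⟨ψ|φ⟩|²` (`exists_matrix_run_bellStep`, `sum_star_mul_swapSystems`). The
exchange acts on the system registers only, so ancillas of purifications are simply summed out.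

Hence `X = 1 - sign` takes values in `{0, 2}` and has mean `T²` and variance at most `2T²`. The
variance shrinks with the mean, so the square root of the empirical mean of `s` independent copies
of `X` is within `ε` of `T` except with probability at most `2 / (s ε²)`
(`sqrt_mean_concentration`). Thus order `1/ε²` repetitions serve both access models; for samples
this is better than the claimed `1/ε⁴`.

The repetitions run side by side on disjoint blocks of wires, so the final state is a product state
with independent outcomes (`run_repeated`), and without queries all gates act on disjoint pairs of
wires, whence constant depth. -/

theorem vecMulVec_star_mul {d : Type} [Fintype d] (a b c e : d → ℂ) :
    Matrix.vecMulVec a (star b) * Matrix.vecMulVec c (star e) =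
      (star b ⬝ᵥ c) • Matrix.vecMulVec a (star e) := by
  rw [Matrix.vecMulVec_mul_vecMulVec, Matrix.vecMulVec_smul]

/-- With `A` the difference and `t² = 1 - |z|²`, the relations `PRP = |z|² P` and `RPR = |z|² R`
give `A³ = t² A`. If `t > 0`, then `A² / t` is positive with square `A²`, so it is `|A|`, and `tr A²
= 2t²` finishes. -/
theorem trace_abs_sub {d : Type} [Fintype d] [DecidableEq d] (a b : d → ℂ)
    (ha : star a ⬝ᵥ a = 1) (hb : star b ⬝ᵥ b = 1) :
    (Matrix.trace (CFC.abs (Matrix.vecMulVec a (star a) - Matrix.vecMulVec b (star b)))).re =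
      2 * Real.sqrt (1 - ‖star a ⬝ᵥ b‖ ^ 2) := by
  set P := Matrix.vecMulVec a (star a) with hP
  set R := Matrix.vecMulVec b (star b) with hR
  set z := star a ⬝ᵥ b with hz
  have hz' : star b ⬝ᵥ a = star z := by
    rw [hz, Matrix.star_dotProduct]
  have hzz : z * star z = ((‖z‖ ^ 2 : ℝ) : ℂ) := by
    rw [Complex.star_def, Complex.mul_conj']
    simp
  have hPP : P * P = P := by rw [hP, vecMulVec_star_mul, ha, one_smul]
  have hRR : R * R = R := by rw [hR, vecMulVec_star_mul, hb, one_smul]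
  have hPRP : P * R * P = (z * star z) • P := by
    rw [hP, hR, vecMulVec_star_mul, Matrix.smul_mul, vecMulVec_star_mul, hz', smul_smul]
  have hRPR : R * P * R = (z * star z) • R := by
    rw [hP, hR, vecMulVec_star_mul, Matrix.smul_mul, vecMulVec_star_mul, hz', smul_smul, mul_comm]
  have hPs : Pᴴ = P := by rw [hP, Matrix.conjTranspose_vecMulVec, star_star]
  have hRs : Rᴴ = R := by rw [hR, Matrix.conjTranspose_vecMulVec, star_star]
  set A := P - R with hA
  have hAs : Aᴴ = A := by rw [hA, Matrix.conjTranspose_sub, hPs, hRs]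
  have hAA : A * A = P + R - P * R - R * P := by
    rw [hA, sub_mul, mul_sub, mul_sub, hPP, hRR]; abel
  have hA3 : A * A * A = ((1 - ‖z‖ ^ 2 : ℝ) : ℂ) • A := by
    have h1 : R * P * P = R * P := by rw [mul_assoc, hPP]
    have h2 : P * R * R = P * R := by rw [mul_assoc, hRR]
    rw [hAA, hA, Complex.ofReal_sub, ← hzz, sub_smul, Complex.ofReal_one, one_smul]
    simp only [sub_mul, add_mul, mul_sub, hPP, hRR, hPRP, hRPR, h1, h2, smul_sub]
    abel
  have htr : Matrix.trace (A * A) = ((2 * (1 - ‖z‖ ^ 2) : ℝ) : ℂ) := by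
    have t1 : Matrix.trace P = 1 := by rw [hP, Matrix.trace_vecMulVec, dotProduct_comm, ha]
    have t2 : Matrix.trace R = 1 := by rw [hR, Matrix.trace_vecMulVec, dotProduct_comm, hb]
    have t3 : Matrix.trace (P * R) = z * star z := by
      rw [hP, hR, vecMulVec_star_mul, Matrix.trace_smul, Matrix.trace_vecMulVec, dotProduct_comm a,
        hz', smul_eq_mul]
    rw [hAA, Matrix.trace_sub, Matrix.trace_sub, Matrix.trace_add, Matrix.trace_mul_comm R P, t1,
      t2, t3, hzz]
    push_cast
    ring
  have hpsd : (A * A).PosSemidef := by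
    have := Matrix.posSemidef_conjTranspose_mul_self A
    rwa [hAs] at this
  have hnn : 0 ≤ 1 - ‖z‖ ^ 2 := by
    have := hpsd.trace_nonneg
    rw [htr, Complex.zero_le_real] at this
    linarith
  -- Division by `t` fails when `t = 0`; then `tr (A† A) = 0` forces `A = 0`.
  rcases hnn.eq_or_lt with h0 | hpos
  · have hA0 : A = 0 := by
      rw [← Matrix.trace_conjTranspose_mul_self_eq_zero_iff, hAs, htr, ← h0]
      simp
    rw [hA0, ← h0]
    simp
  · set t := Real.sqrt (1 - ‖z‖ ^ 2) with ht
    have htpos : 0 < t := Real.sqrt_pos.2 hpos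
    have htt : t * t = 1 - ‖z‖ ^ 2 := Real.mul_self_sqrt hnn
    have habs : CFC.abs A = ((t⁻¹ : ℝ) : ℂ) • (A * A) := by
      have hBnn : (0 : Matrix d d ℂ) ≤ ((t⁻¹ : ℝ) : ℂ) • (A * A) := by
        rw [Matrix.nonneg_iff_posSemidef]
        refine hpsd.smul ?_
        rw [Complex.zero_le_real]
        positivity
      rw [CFC.abs, CFC.sqrt_eq_iff _ _ (star_mul_self_nonneg A) hBnn]
      rw [Matrix.smul_mul, Matrix.mul_smul, smul_smul, ← mul_assoc, hA3, Matrix.smul_mul, smul_smul,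
        Matrix.star_eq_conjTranspose, hAs, ← htt, ← Complex.ofReal_mul, ← Complex.ofReal_mul]
      rw [show t⁻¹ * t⁻¹ * (t * t) = 1 by field_simp]
      simp
    rw [habs, Matrix.trace_smul, htr, ← htt, smul_eq_mul, ← Complex.ofReal_mul, Complex.ofReal_re]
    field_simp

theorem dotProduct_eq_inner {n : ℕ} (ψ φ : QVec n) :
    star (fun x => ψ x) ⬝ᵥ (fun x => φ x) = inner ℂ ψ φ := by
  rw [PiLp.inner_apply, dotProduct]
  refine Finset.sum_congr rfl fun i _ => ?_
  simp [mul_comm]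

theorem traceDistance_pureState {n : ℕ} (ψ φ : QVec n) (hψ : ‖ψ‖ = 1) (hφ : ‖φ‖ = 1) :
    traceDistance (pureState ψ) (pureState φ) = Real.sqrt (1 - ‖inner ℂ ψ φ‖ ^ 2) := by
  have h (χ : QVec n) (hχ : ‖χ‖ = 1) : star (fun x => χ x) ⬝ᵥ (fun x => χ x) = 1 := by
    rw [dotProduct_eq_inner, inner_self_eq_norm_sq_to_K, hχ]
    simp
  have := trace_abs_sub (fun x => ψ x) (fun x => φ x) (h ψ hψ) (h φ hφ)
  rw [dotProduct_eq_inner] at this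
  rw [traceDistance]
  change 1 / 2 * (Matrix.trace (CFC.abs (Matrix.vecMulVec _ (star fun x => ψ x) -
    Matrix.vecMulVec _ (star fun x => φ x)))).re = _
  rw [this]
  ring

/-! ### Operators on selected wires -/

section Extend

variable {ι κ κ' : Type}

theorem extend_comp_of_disjoint {e : κ ↪ ι} {e' : κ' ↪ ι}
    (h : Disjoint (Set.range e) (Set.range e')) (u : Bits κ) (x : Bits ι) :
    Function.extend e u x ∘ e' = x ∘ e' := by
  ext k
  refine Function.extend_apply' _ _ _ ?_
  rintro ⟨l, hl⟩
  exact Set.disjoint_left.1 h ⟨l, hl⟩ ⟨k, rfl⟩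

theorem extend_extend_of_disjoint {e : κ ↪ ι} {e' : κ' ↪ ι}
    (h : Disjoint (Set.range e) (Set.range e')) (u : Bits κ) (u' : Bits κ') (x : Bits ι) :
    Function.extend e u (Function.extend e' u' x) =
      Function.extend e' u' (Function.extend e u x) := by
  ext i
  by_cases hi : ∃ k, e k = i
  · obtain ⟨k, rfl⟩ := hi
    rw [e.injective.extend_apply, Function.extend_apply', e.injective.extend_apply]
    rintro ⟨l, hl⟩
    exact Set.disjoint_left.1 h ⟨k, rfl⟩ ⟨l, hl⟩
  · rw [Function.extend_apply' _ _ _ hi]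
    by_cases hi' : ∃ k, e' k = i
    · obtain ⟨k, rfl⟩ := hi'
      rw [e'.injective.extend_apply, e'.injective.extend_apply]
    · rw [Function.extend_apply' _ _ _ hi', Function.extend_apply' _ _ _ hi',
        Function.extend_apply' _ _ _ hi]

theorem extend_extend (e : κ ↪ ι) (u u' : Bits κ) (x : Bits ι) :
    Function.extend e u (Function.extend e u' x) = Function.extend e u x := by
  ext i
  by_cases hi : ∃ k, e k = i
  · obtain ⟨k, rfl⟩ := hi
    rw [e.injective.extend_apply, e.injective.extend_apply]
  · simp only [Function.extend_apply' _ _ _ hi]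

end Extend

theorem onWires_conjTranspose {ι κ : Type} (e : κ ↪ ι) (A : Matrix (Bits κ) (Bits κ) ℂ) :
    onWires e Aᴴ = (onWires e A)ᴴ := by
  classical
  ext x y
  simp only [onWires, Matrix.conjTranspose_apply]
  have : (∀ i, i ∉ Set.range e → x i = y i) ↔ ∀ i, i ∉ Set.range e → y i = x i :=
    forall_congr' fun i => imp_congr_right fun _ => eq_comm
  simp only [this]
  split_ifs <;> simp

section Wires

variable {ι κ κ' : Type} [Fintype ι] [DecidableEq ι] [Fintype κ] [DecidableEq κ]
  [Fintype κ'] [DecidableEq κ']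

/-- The labels that agree with `x` off the selected wires are exactly `x` with those wires
overwritten by some `u`, which is what `Function.extend e u x` expresses. The algebra of `onWires`
follows from this formula by comparing actions on vectors. -/
theorem onWires_mulVec (e : κ ↪ ι) (U : Matrix (Bits κ) (Bits κ) ℂ) (v : Bits ι → ℂ)
    (x : Bits ι) :
    (onWires e U *ᵥ v) x = ∑ u : Bits κ, U (x ∘ e) u * v (Function.extend e u x) := by
  classical
  simp only [Matrix.mulVec, dotProduct, onWires, ite_mul, zero_mul]
  rw [← Finset.sum_filter]
  refine Finset.sum_nbij' (fun y => y ∘ e) (fun u => Function.extend e u x) ?_ ?_ ?_ ?_ ?_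
  · simp
  · intro u _
    simp only [Finset.mem_filter, Finset.mem_univ, true_and]
    intro i hi
    rw [Function.extend_apply' _ _ _ (by simpa using hi)]
  · intro y hy
    simp only [Finset.mem_filter, Finset.mem_univ, true_and] at hy
    ext i
    by_cases hi : i ∈ Set.range e
    · obtain ⟨k, rfl⟩ := hi
      simp [e.injective.extend_apply]
    · rw [Function.extend_apply' _ _ _ (by simpa using hi), hy i hi]
  · intro u _
    exact Function.extend_comp e.injective _ _
  · intro y hy
    simp only [Finset.mem_filter, Finset.mem_univ, true_and] at hy
    congr 2
    ext i
    by_cases hi : i ∈ Set.range e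
    · obtain ⟨k, rfl⟩ := hi
      simp [e.injective.extend_apply]
    · rw [Function.extend_apply' _ _ _ (by simpa using hi), hy i hi]

theorem matrix_ext_mulVec {A B : Matrix (Bits ι) (Bits ι) ℂ}
    (h : ∀ v x, (A *ᵥ v) x = (B *ᵥ v) x) : A = B :=
  Matrix.mulVec_injective (funext fun v => funext (h v))

theorem onWires_mul (e : κ ↪ ι) (A B : Matrix (Bits κ) (Bits κ) ℂ) :
    onWires e (A * B) = onWires e A * onWires e B := by
  refine matrix_ext_mulVec fun v x => ?_
  rw [← Matrix.mulVec_mulVec, onWires_mulVec, onWires_mulVec]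
  simp only [onWires_mulVec, extend_extend, Function.extend_comp e.injective, Matrix.mul_apply,
    Finset.sum_mul, Finset.mul_sum]
  rw [Finset.sum_comm]
  simp only [mul_assoc]

/-- Overwriting two disjoint sets of wires gives the same label in either order, so the two double
sums agree. -/
theorem onWires_commute {e : κ ↪ ι} {e' : κ' ↪ ι}
    (h : Disjoint (Set.range e) (Set.range e'))
    (A : Matrix (Bits κ) (Bits κ) ℂ) (B : Matrix (Bits κ') (Bits κ') ℂ) :
    Commute (onWires e A) (onWires e' B) := by
  refine matrix_ext_mulVec fun v x => ?_
  rw [← Matrix.mulVec_mulVec, ← Matrix.mulVec_mulVec, onWires_mulVec, onWires_mulVec]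
  simp only [onWires_mulVec, extend_comp_of_disjoint h, extend_comp_of_disjoint h.symm,
    Finset.mul_sum, extend_extend_of_disjoint h]
  rw [Finset.sum_comm]
  refine Finset.sum_congr rfl fun _ _ => Finset.sum_congr rfl fun _ _ => ?_
  ring

theorem onWires_diagonal (e : κ ↪ ι) (d : Bits κ → ℂ) :
    onWires e (Matrix.diagonal d) = Matrix.diagonal fun x => d (x ∘ e) := by
  refine matrix_ext_mulVec fun v x => ?_
  rw [onWires_mulVec, Matrix.mulVec_diagonal, Finset.sum_eq_single (x ∘ e)]
  · rw [Matrix.diagonal_apply_eq]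
    congr 2
    ext i
    by_cases hi : ∃ k, e k = i
    · obtain ⟨k, rfl⟩ := hi
      rw [e.injective.extend_apply, Function.comp_apply]
    · rw [Function.extend_apply' _ _ _ hi]
  · intro u _ hu
    rw [Matrix.diagonal_apply_ne _ hu.symm, zero_mul]
  · simp

theorem onWires_one (e : κ ↪ ι) : onWires e (1 : Matrix (Bits κ) (Bits κ) ℂ) = 1 := by
  rw [← Matrix.diagonal_one, onWires_diagonal, Matrix.diagonal_one]

end Wires

/-! ### Parallel repetition of a circuit -/

section Repeat

variable {ι ι' β Q : Type} {κ : Q → Type}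

/-- Relabel the wires of a step. -/
def Step.map (f : ι ↪ ι') : Step ι Q κ → Step ι' Q κ
  | gate k hk u e => gate k hk u (e.trans f)
  | query q inverse e => query q inverse (e.trans f)
  | controlledQuery q inverse e => controlledQuery q inverse (e.trans f)

theorem Step.wires_map (f : ι ↪ ι') (g : Step ι Q κ) : (g.map f).wires = f '' g.wires := by
  cases g with
  | gate _ _ _ e => exact Set.range_comp f e
  | query _ _ e => exact Set.range_comp f e
  | controlledQuery _ _ e => exact Set.range_comp f e

theorem Step.isQuery_map (f : ι ↪ ι') (g : Step ι Q κ) : (g.map f).isQuery = g.isQuery := by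
  cases g <;> rfl

/-- Puts gates, queries and controlled queries in one form, so that the later analysis of relabelled
circuits needs no case distinction. -/
theorem Step.exists_matrix_map [∀ q, Fintype (κ q)] [∀ q, DecidableEq (κ q)]
    (O : ∀ q, Matrix.unitaryGroup (Bits (κ q)) ℂ) (g : Step ι Q κ) :
    ∃ (γ : Type) (_ : Fintype γ) (_ : DecidableEq γ) (e : γ ↪ ι) (U : Matrix (Bits γ) (Bits γ) ℂ),
      g.matrix O = onWires e U ∧
        ∀ (ι' : Type) (f : ι ↪ ι'), (g.map f).matrix O = onWires (e.trans f) U := by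
  cases g with
  | gate k hk u e => exact ⟨Fin k, inferInstance, inferInstance, e, _, rfl, fun _ _ => rfl⟩
  | query q b e => exact ⟨κ q, inferInstance, inferInstance, e, _, rfl, fun _ _ => rfl⟩
  | controlledQuery q b e =>
    exact ⟨Option (κ q), inferInstance, inferInstance, e, _, rfl, fun _ _ => rfl⟩

/-- The wires of the `i`-th block of a register that is divided into `s` blocks. -/
def blockEmb {s : ℕ} (e : Fin s × β ≃ ι) (i : Fin s) : β ↪ ι :=
  ⟨fun b => e (i, b), fun _ _ h => (Prod.mk.inj (e.injective h)).2⟩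

/-- Run a copy of the circuit on every block. -/
def Circuit.repeated {s : ℕ} (e : Fin s × β ≃ ι) (c : Circuit β Q κ) : Circuit ι Q κ :=
  (List.finRange s).flatMap fun i => c.map (Step.map (blockEmb e i))

theorem Circuit.size_repeated {s : ℕ} (e : Fin s × β ≃ ι) (c : Circuit β Q κ) :
    (c.repeated e).size = s * c.size := by
  simp [Circuit.repeated, Circuit.size, List.length_flatMap]

theorem Circuit.queryCount_repeated {s : ℕ} (e : Fin s × β ≃ ι) (c : Circuit β Q κ) :
    (c.repeated e).queryCount = s * c.queryCount := by
  have h (i : Fin s) : (Step.isQuery : Step ι Q κ → Bool) ∘ Step.map (blockEmb e i) =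
      Step.isQuery := funext (Step.isQuery_map _)
  simp [Circuit.repeated, Circuit.queryCount, List.countP_flatMap, List.countP_map, h,
    Function.comp_def]

/-- The product of block states. -/
def productState {s : ℕ} (e : Fin s × β ≃ ι) (f : Fin s → Bits β → ℂ) : Bits ι → ℂ :=
  fun x => ∏ k, f k (x ∘ blockEmb e k)

theorem extend_comp_blockEmb {s : ℕ} (e : Fin s × β ≃ ι) {γ : Type} (g : γ ↪ β) (i : Fin s)
    (u : Bits γ) (x : Bits ι) :
    Function.extend (g.trans (blockEmb e i)) u x ∘ blockEmb e i =
      Function.extend g u (x ∘ blockEmb e i) := by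
  ext b
  by_cases hb : ∃ c, g c = b
  · obtain ⟨c, rfl⟩ := hb
    rw [g.injective.extend_apply]
    exact (g.trans (blockEmb e i)).injective.extend_apply u x c
  · rw [Function.extend_apply' _ _ _ hb]
    refine Function.extend_apply' _ _ _ ?_
    rintro ⟨c, hc⟩
    exact hb ⟨c, (blockEmb e i).injective hc⟩

theorem disjoint_range_blockEmb {s : ℕ} (e : Fin s × β ≃ ι) {i k : Fin s} (h : i ≠ k) :
    Disjoint (Set.range (blockEmb e i)) (Set.range (blockEmb e k)) := by
  rw [Set.disjoint_left]
  rintro _ ⟨b, rfl⟩ ⟨c, hc⟩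
  exact h (Prod.mk.inj (e.injective hc)).1.symm

variable [Fintype ι] [DecidableEq ι] [Fintype β] [DecidableEq β]

/-- Overwriting wires of block `i` leaves the labels of the other blocks unchanged, so their factors
come out of the sum. -/
theorem onWires_productState {s : ℕ} (e : Fin s × β ≃ ι) {γ : Type} [Fintype γ] [DecidableEq γ]
    (g : γ ↪ β) (U : Matrix (Bits γ) (Bits γ) ℂ) (i : Fin s) (f : Fin s → Bits β → ℂ) :
    onWires (g.trans (blockEmb e i)) U *ᵥ productState e f =
      productState e (Function.update f i (onWires g U *ᵥ f i)) := by
  ext x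
  rw [onWires_mulVec]
  simp only [productState]
  rw [← Finset.mul_prod_erase _ _ (Finset.mem_univ i), Function.update_self, onWires_mulVec,
    Finset.sum_mul]
  refine Finset.sum_congr rfl fun u _ => ?_
  rw [← Finset.mul_prod_erase _ _ (Finset.mem_univ i), extend_comp_blockEmb, mul_assoc]
  congr 2
  refine Finset.prod_congr rfl fun k hk => ?_
  have hki : k ≠ i := Finset.ne_of_mem_erase hk
  rw [Function.update_of_ne hki, extend_comp_of_disjoint]
  refine (disjoint_range_blockEmb e hki.symm).mono_left ?_
  rintro _ ⟨c, rfl⟩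
  exact ⟨g c, rfl⟩

variable [∀ q, Fintype (κ q)] [∀ q, DecidableEq (κ q)]
  (O : ∀ q, Matrix.unitaryGroup (Bits (κ q)) ℂ)

theorem run_map_blockEmb {s : ℕ} (e : Fin s × β ≃ ι) (c : Circuit β Q κ) (i : Fin s)
    (f : Fin s → Bits β → ℂ) :
    Circuit.run O (c.map (Step.map (blockEmb e i))) (productState e f) =
      productState e (Function.update f i (c.run O (f i))) := by
  induction c generalizing f with
  | nil => simp [Circuit.run]
  | cons g c ih =>
    obtain ⟨γ, _, _, e', U, h1, h2⟩ := g.exists_matrix_map O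
    have := ih (Function.update f i (onWires e' U *ᵥ f i))
    simp only [Circuit.run, List.map_cons, List.foldl_cons] at this ⊢
    rw [h2, h1, onWires_productState, this]
    simp

/-- The form of `run_repeated` suited to induction: only the listed blocks have been processed, and
`Nodup` ensures that each is processed once. -/
theorem run_flatMap_blockEmb {s : ℕ} (e : Fin s × β ≃ ι) (c : Circuit β Q κ) (l : List (Fin s))
    (hl : l.Nodup) (f : Fin s → Bits β → ℂ) :
    Circuit.run O (l.flatMap fun i => c.map (Step.map (blockEmb e i))) (productState e f) =
      productState e (fun i => if i ∈ l then c.run O (f i) else f i) := by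
  induction l generalizing f with
  | nil => simp [Circuit.run]
  | cons i l ih =>
    rw [List.nodup_cons] at hl
    rw [List.flatMap_cons, Circuit.run, List.foldl_append]
    have h := run_map_blockEmb O e c i f
    rw [Circuit.run] at h
    rw [h]
    refine (ih hl.2 _).trans ?_
    congr 1
    funext k
    by_cases hk : k = i
    · subst hk
      simp [hl.1]
    · simp [hk]

theorem run_repeated {s : ℕ} (e : Fin s × β ≃ ι) (c : Circuit β Q κ) (f : Bits β → ℂ) :
    Circuit.run O (c.repeated e) (productState e fun _ => f) =
      productState e fun _ => c.run O f := by
  rw [Circuit.repeated, run_flatMap_blockEmb O e c _ (List.nodup_finRange s)]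
  simp

end Repeat

/-! ### Concentration -/

section Concentration

variable {Y : Type} [Fintype Y]

theorem sum_prod_eq_one (q : Y → ℝ) (hq : ∑ y, q y = 1) (s : ℕ) :
    ∑ x : Fin s → Y, ∏ i, q (x i) = 1 := by
  classical
  rw [← Fintype.piFinset_univ, ← Finset.prod_univ_sum]
  simp [hq]

theorem sum_fin_succ_arrow {s : ℕ} (F : (Fin (s + 1) → Y) → ℝ) :
    ∑ x, F x = ∑ y, ∑ x : Fin s → Y, F (Fin.cons y x) := by
  classical
  rw [← (Fin.consEquiv fun _ => Y).sum_comp, Fintype.sum_prod_type]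
  rfl

theorem sum_prod_mul_sum (q d : Y → ℝ) (hq : ∑ y, q y = 1) (hd : ∑ y, q y * d y = 0) (s : ℕ) :
    ∑ x : Fin s → Y, (∏ i, q (x i)) * ∑ i, d (x i) = 0 := by
  induction s with
  | zero => simp
  | succ s ih =>
    rw [sum_fin_succ_arrow]
    simp only [Fin.prod_univ_succ, Fin.sum_univ_succ, Fin.cons_zero, Fin.cons_succ]
    have h (y : Y) : ∑ x : Fin s → Y, q y * (∏ i, q (x i)) * (d y + ∑ i, d (x i)) =
        q y * d y := by
      calc _ = q y * d y * (∑ x : Fin s → Y, ∏ i, q (x i)) +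
          q y * ∑ x : Fin s → Y, (∏ i, q (x i)) * ∑ i, d (x i) := by
            rw [Finset.mul_sum, Finset.mul_sum, ← Finset.sum_add_distrib]
            exact Finset.sum_congr rfl fun _ _ => by ring
        _ = _ := by rw [ih, sum_prod_eq_one q hq]; ring
    simp only [h, hd]

/-- Additivity of variance for independent centred variables: on splitting off the first one, the
cross term vanishes by `sum_prod_mul_sum`. -/
theorem sum_prod_mul_sq_sum (q d : Y → ℝ) (hq : ∑ y, q y = 1) (hd : ∑ y, q y * d y = 0) (s : ℕ) :
    ∑ x : Fin s → Y, (∏ i, q (x i)) * (∑ i, d (x i)) ^ 2 = s * ∑ y, q y * d y ^ 2 := by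
  induction s with
  | zero => simp
  | succ s ih =>
    rw [sum_fin_succ_arrow]
    simp only [Fin.prod_univ_succ, Fin.sum_univ_succ, Fin.cons_zero, Fin.cons_succ]
    have h (y : Y) : ∑ x : Fin s → Y, q y * (∏ i, q (x i)) * (d y + ∑ i, d (x i)) ^ 2 =
        q y * d y ^ 2 + q y * (s * ∑ y, q y * d y ^ 2) := by
      calc _ = q y * d y ^ 2 * (∑ x : Fin s → Y, ∏ i, q (x i)) +
          2 * q y * d y * (∑ x : Fin s → Y, (∏ i, q (x i)) * ∑ i, d (x i)) +
          q y * ∑ x : Fin s → Y, (∏ i, q (x i)) * (∑ i, d (x i)) ^ 2 := by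
            rw [Finset.mul_sum, Finset.mul_sum, Finset.mul_sum, ← Finset.sum_add_distrib,
              ← Finset.sum_add_distrib]
            exact Finset.sum_congr rfl fun _ _ => by ring
        _ = _ := by rw [ih, sum_prod_eq_one q hq, sum_prod_mul_sum q d hq hd]; ring
    simp only [h, Finset.sum_add_distrib, ← Finset.sum_mul, hq]
    push_cast
    ring

/-- If a `{0, 2}`-valued variable has mean `t²`, then the square root of its empirical mean is
close to `t`. -/
theorem sqrt_mean_concentration (q X : Y → ℝ) (hq0 : ∀ y, 0 ≤ q y) (hq : ∑ y, q y = 1)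
    (hX : ∀ y, X y ^ 2 = 2 * X y) {t : ℝ} (ht : 0 ≤ t) (hm : ∑ y, q y * X y = t ^ 2)
    {ε η : ℝ} (hε : 0 < ε) (hη : 0 < η) (s : ℕ) (hs : 2 / (η * ε ^ 2) ≤ s) :
    1 - η ≤ ∑ x : Fin s → Y,
      if |Real.sqrt ((∑ i, X (x i)) / s) - t| ≤ ε then ∏ i, q (x i) else 0 := by
  classical
  have hs0 : (0 : ℝ) < s := lt_of_lt_of_le (by positivity) hs
  -- The failure probability.
  set B : ℝ := ∑ x : Fin s → Y,
    if |Real.sqrt ((∑ i, X (x i)) / s) - t| ≤ ε then 0 else ∏ i, q (x i) with hB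
  have hsplit : (∑ x : Fin s → Y,
      if |Real.sqrt ((∑ i, X (x i)) / s) - t| ≤ ε then ∏ i, q (x i) else 0) = 1 - B := by
    rw [eq_sub_iff_add_eq, hB, ← Finset.sum_add_distrib, ← sum_prod_eq_one q hq s]
    refine Finset.sum_congr rfl fun x _ => ?_
    split_ifs <;> simp
  rw [hsplit]
  have hprod (x : Fin s → Y) : 0 ≤ ∏ i, q (x i) := Finset.prod_nonneg fun i _ => hq0 _
  have hX0 (y : Y) : 0 ≤ X y := by nlinarith [hX y, sq_nonneg (X y)]
  have hmean : ∑ y, q y * (X y - t ^ 2) = 0 := by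
    simp only [mul_sub, Finset.sum_sub_distrib, ← Finset.sum_mul, hq, hm]
    ring
  have hvar : ∑ y, q y * (X y - t ^ 2) ^ 2 ≤ 2 * t ^ 2 := by
    have : ∑ y, q y * (X y - t ^ 2) ^ 2 = 2 * t ^ 2 - t ^ 4 := by
      have h (y : Y) : q y * (X y - t ^ 2) ^ 2 =
          (2 - 2 * t ^ 2) * (q y * X y) + q y * t ^ 4 := by
        rw [sub_sq, hX]; ring
      simp only [h, Finset.sum_add_distrib, ← Finset.mul_sum, ← Finset.sum_mul, hq, hm]
      ring
    rw [this]
    nlinarith [sq_nonneg (t ^ 2)]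
  -- Chebyshev's inequality: on failure `|r² - t²| = |r - t| (r + t)`, where `r` is the estimate,
  -- `|r - t| > ε`, and `r + t` is at least both `t` and `|r - t|`, hence at least `m`.
  have hchain (m : ℝ) (hm0 : 0 ≤ m) (hmm : m ≤ max t ε) : B * (s ^ 2 * ε ^ 2 * m ^ 2) ≤
      s * (2 * t ^ 2) := by
    refine le_trans ?_ (mul_le_mul_of_nonneg_left hvar hs0.le)
    rw [← sum_prod_mul_sq_sum q _ hq hmean s, hB, Finset.sum_mul]
    refine Finset.sum_le_sum fun x _ => ?_
    split_ifs with h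
    · rw [zero_mul]
      exact mul_nonneg (hprod x) (sq_nonneg _)
    · refine mul_le_mul_of_nonneg_left ?_ (hprod x)
      push Not at h
      set r := Real.sqrt ((∑ i, X (x i)) / s) with hr
      have hr0 : 0 ≤ r := Real.sqrt_nonneg _
      have hrr : r ^ 2 = (∑ i, X (x i)) / s :=
        Real.sq_sqrt (div_nonneg (Finset.sum_nonneg fun i _ => hX0 _) hs0.le)
      have hsum : ∑ i, (X (x i) - t ^ 2) = s * ((r - t) * (r + t)) := by
        rw [Finset.sum_sub_distrib, show (r - t) * (r + t) = r ^ 2 - t ^ 2 by ring, hrr]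
        simp
        field_simp
      rw [hsum, mul_pow, mul_pow, mul_assoc]
      refine mul_le_mul_of_nonneg_left ?_ (by positivity)
      have h1 : ε ^ 2 ≤ (r - t) ^ 2 := by
        rw [← sq_abs (r - t)]
        exact pow_le_pow_left₀ hε.le h.le 2
      have h2 : m ≤ r + t := by
        refine hmm.trans (max_le (by linarith) (h.le.trans ?_))
        rw [abs_le]
        constructor <;> linarith
      exact mul_le_mul h1 (pow_le_pow_left₀ hm0 h2 2) (by positivity) (by positivity)
  have hηs : 2 ≤ η * ε ^ 2 * s := by
    rw [div_le_iff₀ (by positivity)] at hs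
    linarith
  suffices B ≤ η by linarith
  rcases ht.eq_or_lt with h0 | hpos
  -- For `t = 0` the variance vanishes; the choice `m = ε` keeps the factor of `B` positive, which
  -- excludes `B > η`.
  · have := hchain ε hε.le (le_max_right _ _)
    rw [← h0] at this
    by_contra! hlt
    have : 0 < B * (s ^ 2 * ε ^ 2 * ε ^ 2) := mul_pos (hη.trans hlt) (by positivity)
    linarith
  · have := hchain t ht (le_max_left _ _)
    have h3 : B * (s * ε ^ 2) ≤ 2 := by
      have h4 : 0 < s * t ^ 2 := by positivity
      refine le_of_mul_le_mul_right ?_ h4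
      linarith
    have h5 : B * (s * ε ^ 2) ≤ η * (s * ε ^ 2) := by linarith
    exact le_of_mul_le_mul_right h5 (by positivity)

/-- The outcome distribution of a product state is the product of the block distributions, so the
blocks are independent samples for `sqrt_mean_concentration`. -/
theorem probWithin_productState {ι β : Type} [Fintype ι] [DecidableEq ι] [Fintype β]
    [DecidableEq β] {s : ℕ} (e : Fin s × β ≃ ι) (f : Bits β → ℂ) (X : Bits β → ℝ)
    (hf : ∑ y, ‖f y‖ ^ 2 = 1) (hX : ∀ y, X y ^ 2 = 2 * X y) {t : ℝ} (ht : 0 ≤ t)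
    (hm : ∑ y, ‖f y‖ ^ 2 * X y = t ^ 2) {ε η : ℝ} (hε : 0 < ε) (hη : 0 < η)
    (hs : 2 / (η * ε ^ 2) ≤ s) :
    1 - η ≤ probWithin (productState e fun _ => f)
      (fun x => Real.sqrt ((∑ i, X (x ∘ blockEmb e i)) / s)) t ε := by
  refine (sqrt_mean_concentration _ X (fun y => sq_nonneg _) hf hX ht hm hε hη s hs).trans_eq ?_
  rw [probWithin]
  let E : (Fin s → Bits β) ≃ Bits ι :=
    (Equiv.curry (Fin s) β Bool).symm.trans (e.arrowCongr (Equiv.refl Bool))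
  rw [← E.sum_comp]
  refine Finset.sum_congr rfl fun x _ => ?_
  have h (i : Fin s) : E x ∘ blockEmb e i = x i := by
    ext b
    change Function.uncurry x (e.symm (e (i, b))) = _
    simp
  simp only [h, productState, norm_prod, Finset.prod_pow]

end Concentration

/-! ### The two-qubit gate of the swap test -/

theorem sum_bits_two {M : Type} [AddCommMonoid M] (F : Bits (Fin 2) → M) :
    ∑ x, F x = F ![true, true] + F ![true, false] + (F ![false, true] + F ![false, false]) := by
  rw [← (finTwoArrowEquiv Bool).symm.sum_comp, Fintype.sum_prod_type]
  simp [finTwoArrowEquiv]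

/-- A `CNOT` gate followed by a Hadamard gate on the control qubit. -/
def bellMatrix : Matrix (Bits (Fin 2)) (Bits (Fin 2)) ℂ := fun x y =>
  if x 1 = xor (y 0) (y 1) then
    (if (x 0 && y 0) = true then -1 else 1) * ((Real.sqrt 2)⁻¹ : ℝ) else 0

/-- The sign of an outcome of the Bell measurement: negative for the singlet. -/
def bellSign (x : Bits (Fin 2)) : ℝ := if (x 0 && x 1) = true then -1 else 1

/-- The operator that exchanges two qubits. -/
def swapMatrix : Matrix (Bits (Fin 2)) (Bits (Fin 2)) ℂ := fun x y =>
  if y = ![x 1, x 0] then 1 else 0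

theorem inv_sqrt_two_mul_self : (((Real.sqrt 2)⁻¹ : ℝ) : ℂ) * (((Real.sqrt 2)⁻¹ : ℝ) : ℂ) = 2⁻¹ := by
  rw [← Complex.ofReal_mul, ← mul_inv, Real.mul_self_sqrt (by norm_num)]
  norm_num

theorem bits_two_cases {p : Bits (Fin 2) → Prop} (h : ∀ a b, p ![a, b]) (x : Bits (Fin 2)) :
    p x := by
  have := h (x 0) (x 1)
  rwa [show ![x 0, x 1] = x by ext i; fin_cases i <;> rfl] at this

/-- The Bell basis diagonalises the exchange of two qubits: the singlet, read out as `11`, has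
eigenvalue -1 and the other three states have eigenvalue +1. -/
theorem bellMatrix_conj_sign :
    bellMatrixᴴ * Matrix.diagonal (fun x => (bellSign x : ℂ)) * bellMatrix = swapMatrix := by
  ext x y
  rw [Matrix.mul_apply, sum_bits_two]
  simp only [Matrix.mul_diagonal, Matrix.conjTranspose_apply]
  have h := inv_sqrt_two_mul_self
  generalize hr : (((Real.sqrt 2)⁻¹ : ℝ) : ℂ) = r at h
  have hs : star r = r := by rw [← hr, Complex.star_def, Complex.conj_ofReal]
  induction x using bits_two_cases with | h a b
  induction y using bits_two_cases with | h c d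
  cases a <;> cases b <;> cases c <;> cases d <;>
    simp [bellMatrix, bellSign, swapMatrix, hr, hs, h] <;> norm_num

theorem bellMatrix_conj_self : bellMatrixᴴ * bellMatrix = 1 := by
  ext x y
  rw [Matrix.mul_apply, sum_bits_two]
  simp only [Matrix.conjTranspose_apply]
  have h := inv_sqrt_two_mul_self
  generalize hr : (((Real.sqrt 2)⁻¹ : ℝ) : ℂ) = r at h
  have hs : star r = r := by rw [← hr, Complex.star_def, Complex.conj_ofReal]
  induction x using bits_two_cases with | h a b
  induction y using bits_two_cases with | h c d
  cases a <;> cases b <;> cases c <;> cases d <;>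
    simp [bellMatrix, hr, hs, h] <;> norm_num

def bellGate : Matrix.unitaryGroup (Bits (Fin 2)) ℂ :=
  ⟨bellMatrix, Matrix.mem_unitaryGroup_iff'.2 bellMatrix_conj_self⟩

theorem onWires_swapMatrix {ι : Type} [Fintype ι] [DecidableEq ι] (e : Fin 2 ↪ ι)
    (v : Bits ι → ℂ) (x : Bits ι) :
    (onWires e swapMatrix *ᵥ v) x = v (Function.extend e ![x (e 1), x (e 0)] x) := by
  rw [onWires_mulVec]
  simp [swapMatrix]

/-! ### The swap test on one pair of states -/

section SwapTest

variable {n : ℕ} {κ₁ κ₂ : Type}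

/-- The wires of two `n`-qubit registers with ancilla. -/
abbrev PairWires (n : ℕ) (κ₁ κ₂ : Type) : Type := (Fin n ⊕ κ₁) ⊕ (Fin n ⊕ κ₂)

/-- The `j`-th qubits of the two registers. -/
def pairEmb (j : Fin n) : Fin 2 ↪ PairWires n κ₁ κ₂ :=
  ⟨![Sum.inl (Sum.inl j), Sum.inr (Sum.inl j)], by
    intro a b h
    fin_cases a <;> fin_cases b <;> simp_all⟩

@[simp]
theorem pairEmb_zero (j : Fin n) :
    pairEmb (κ₁ := κ₁) (κ₂ := κ₂) j 0 = Sum.inl (Sum.inl j) := rfl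

@[simp]
theorem pairEmb_one (j : Fin n) :
    pairEmb (κ₁ := κ₁) (κ₂ := κ₂) j 1 = Sum.inr (Sum.inl j) := rfl

theorem range_pairEmb (j : Fin n) : Set.range (pairEmb (κ₁ := κ₁) (κ₂ := κ₂) j) =
    {Sum.inl (Sum.inl j), Sum.inr (Sum.inl j)} :=
  Matrix.range_cons_cons_empty _ _ _

theorem disjoint_range_pairEmb {j k : Fin n} (h : j ≠ k) :
    Disjoint (Set.range (pairEmb (κ₁ := κ₁) (κ₂ := κ₂) j)) (Set.range (pairEmb k)) := by
  rw [range_pairEmb, range_pairEmb]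
  simp [h.symm]

/-- Exchange the qubits of the two registers that are in the list. -/
def swapOn (l : List (Fin n)) (x : Bits (PairWires n κ₁ κ₂)) : Bits (PairWires n κ₁ κ₂) :=
  Sum.elim
    (Sum.elim (fun j => if j ∈ l then x (Sum.inr (Sum.inl j)) else x (Sum.inl (Sum.inl j)))
      fun z => x (Sum.inl (Sum.inr z)))
    (Sum.elim (fun j => if j ∈ l then x (Sum.inl (Sum.inl j)) else x (Sum.inr (Sum.inl j)))
      fun z => x (Sum.inr (Sum.inr z)))

theorem extend_swapOn {j : Fin n} {l : List (Fin n)} (hj : j ∉ l)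
    (x : Bits (PairWires n κ₁ κ₂)) :
    Function.extend (pairEmb j) ![swapOn l x (pairEmb j 1), swapOn l x (pairEmb j 0)]
      (swapOn l x) = swapOn (j :: l) x := by
  ext b
  by_cases hb : ∃ k, pairEmb j k = b
  · obtain ⟨k, rfl⟩ := hb
    rw [(pairEmb j).injective.extend_apply]
    fin_cases k <;> simp [swapOn, hj]
  · rw [Function.extend_apply' _ _ _ hb]
    have h0 : Sum.inl (Sum.inl j) ≠ b := fun h => hb ⟨0, h⟩
    have h1 : Sum.inr (Sum.inl j) ≠ b := fun h => hb ⟨1, h⟩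
    rcases b with (k | z) | (k | z)
    · have : k ≠ j := fun h => h0 (by rw [h])
      simp [swapOn, this]
    · rfl
    · have : k ≠ j := fun h => h1 (by rw [h])
      simp [swapOn, this]
    · rfl

/-- The sign of an outcome of the swap test. -/
def swapSign (x : Bits (PairWires n κ₁ κ₂)) : ℝ :=
  ((List.finRange n).map fun j => bellSign (x ∘ pairEmb j)).prod

theorem swapSign_sq (x : Bits (PairWires n κ₁ κ₂)) : swapSign x ^ 2 = 1 := by
  rw [swapSign]
  induction List.finRange n with
  | nil => simp
  | cons j l ih =>
    rw [List.map_cons, List.prod_cons, mul_pow, ih, bellSign]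
    split_ifs <;> norm_num

/-- Exchange the system registers. -/
def swapSystems (x : Bits (PairWires n κ₁ κ₂)) : Bits (PairWires n κ₁ κ₂) :=
  Sum.elim (Sum.elim (fun j => x (Sum.inr (Sum.inl j))) fun z => x (Sum.inl (Sum.inr z)))
    (Sum.elim (fun j => x (Sum.inl (Sum.inl j))) fun z => x (Sum.inr (Sum.inr z)))

variable {Q : Type} {κ : Q → Type}

def bellStep (Q : Type) (κ : Q → Type) (j : Fin n) : Step (PairWires n κ₁ κ₂) Q κ :=
  Step.gate 2 le_rfl bellGate (pairEmb j)

/-- The destructive swap test: a Bell measurement on each pair of corresponding qubits. -/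
def bellCircuit (n : ℕ) (κ₁ κ₂ Q : Type) (κ : Q → Type) : Circuit (PairWires n κ₁ κ₂) Q κ :=
  (List.finRange n).map (bellStep Q κ)

variable [Fintype κ₁] [DecidableEq κ₁] [Fintype κ₂] [DecidableEq κ₂]

/-- Kept as a product of one-pair observables so that commutation with gates on other pairs is
immediate; `signMatrix_eq_diagonal` gives the form needed for expectations. -/
def signMatrix (l : List (Fin n)) :
    Matrix (Bits (PairWires n κ₁ κ₂)) (Bits (PairWires n κ₁ κ₂)) ℂ :=
  (l.map fun j => onWires (pairEmb j) (Matrix.diagonal fun x => (bellSign x : ℂ))).prod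

theorem signMatrix_eq_diagonal (l : List (Fin n)) :
    signMatrix (κ₁ := κ₁) (κ₂ := κ₂) l =
      Matrix.diagonal fun x => (((l.map fun j => bellSign (x ∘ pairEmb j)).prod : ℝ) : ℂ) := by
  induction l with
  | nil => simp [signMatrix]
  | cons j l ih =>
    rw [signMatrix] at ih ⊢
    rw [List.map_cons, List.prod_cons, ih, onWires_diagonal, Matrix.diagonal_mul_diagonal]
    simp

theorem signMatrix_commute (l : List (Fin n)) {k : Fin n} (hk : k ∉ l)
    (A : Matrix (Bits (Fin 2)) (Bits (Fin 2)) ℂ) :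
    Commute (signMatrix l) (onWires (pairEmb (κ₁ := κ₁) (κ₂ := κ₂) k) A) := by
  refine Commute.list_prod_left _ _ fun M hM => ?_
  obtain ⟨j, hj, rfl⟩ := List.mem_map.1 hM
  exact onWires_commute (disjoint_range_pairEmb (ne_of_mem_of_not_mem hj hk)) _ _

variable [∀ q, Fintype (κ q)] [∀ q, DecidableEq (κ q)]
  (O : ∀ q, Matrix.unitaryGroup (Bits (κ q)) ℂ)

/-- The swap test measures the operator that exchanges the two registers. -/
theorem exists_matrix_run_bellStep (l : List (Fin n)) (hl : l.Nodup) :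
    ∃ M : Matrix (Bits (PairWires n κ₁ κ₂)) (Bits (PairWires n κ₁ κ₂)) ℂ,
      (∀ v, Circuit.run O (l.map (bellStep Q κ)) v = M *ᵥ v) ∧
      (∀ k, k ∉ l → ∀ A, Commute M (onWires (pairEmb k) A)) ∧
      Mᴴ * M = 1 ∧
      ∀ v x, ((Mᴴ * signMatrix l * M) *ᵥ v) x = v (swapOn l x) := by
  -- The commutation clause for pairs outside `l` is what carries the induction.
  induction l with
  | nil =>
    refine ⟨1, fun v => by simp [Circuit.run], fun _ _ _ => Commute.one_left _, by simp,
      fun v x => ?_⟩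
    have : swapOn [] x = x := by
      ext b
      rcases b with (_ | _) | (_ | _) <;> rfl
    simp [signMatrix, this]
  | cons j l ih =>
    rw [List.nodup_cons] at hl
    obtain ⟨M, h1, h2, h3, h4⟩ := ih hl.2
    have h2' (A) : Commute Mᴴ (onWires (pairEmb j) A) := by
      have := h2 j hl.1 Aᴴ
      rw [onWires_conjTranspose] at this
      simpa [Matrix.star_eq_conjTranspose] using this.star_star
    have hS (A) : Commute (Mᴴ * signMatrix l * M) (onWires (pairEmb j) A) :=
      ((h2' A).mul_left (signMatrix_commute l hl.1 A)).mul_left (h2 j hl.1 A)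
    refine ⟨M * onWires (pairEmb j) bellMatrix, fun v => ?_, fun k hk A => ?_, ?_, fun v x => ?_⟩
    · rw [← Matrix.mulVec_mulVec, ← h1]
      rfl
    · rw [List.mem_cons, not_or] at hk
      exact (h2 k hk.2 A).mul_left (onWires_commute (disjoint_range_pairEmb (Ne.symm hk.1)) _ _)
    · rw [Matrix.conjTranspose_mul, Matrix.mul_assoc, ← Matrix.mul_assoc Mᴴ, h3, Matrix.one_mul,
        ← onWires_conjTranspose, ← onWires_mul, bellMatrix_conj_self, onWires_one]
    · have hcons : signMatrix (κ₁ := κ₁) (κ₂ := κ₂) (j :: l) =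
          onWires (pairEmb j) (Matrix.diagonal fun x => (bellSign x : ℂ)) * signMatrix l := rfl
      -- The observable of pair `j` commutes past `Mᴴ`, and everything on pair `j` commutes with the
      -- conjugated observable of `l`. The factors on pair `j` then meet and combine to the exchange
      -- of that pair.
      have key : (M * onWires (pairEmb j) bellMatrix)ᴴ * signMatrix (j :: l) *
          (M * onWires (pairEmb j) bellMatrix) =
          (Mᴴ * signMatrix l * M) * onWires (pairEmb j) swapMatrix := by
        rw [← bellMatrix_conj_sign, onWires_mul, onWires_mul, Matrix.conjTranspose_mul, hcons,
          ← onWires_conjTranspose]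
        calc _ = onWires (pairEmb j) bellMatrixᴴ * ((Mᴴ * onWires (pairEmb j)
              (Matrix.diagonal fun x => (bellSign x : ℂ))) * signMatrix l * M) *
              onWires (pairEmb j) bellMatrix := by noncomm_ring
          _ = onWires (pairEmb j) bellMatrixᴴ * (onWires (pairEmb j)
              (Matrix.diagonal fun x => (bellSign x : ℂ)) * (Mᴴ * signMatrix l * M)) *
              onWires (pairEmb j) bellMatrix := by rw [(h2' _).eq]; noncomm_ring
          _ = (onWires (pairEmb j) bellMatrixᴴ * (Mᴴ * signMatrix l * M)) * (onWires (pairEmb j)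
              (Matrix.diagonal fun x => (bellSign x : ℂ)) *
              onWires (pairEmb j) bellMatrix) := by rw [← (hS _).eq]; noncomm_ring
          _ = _ := by rw [← (hS _).eq]; noncomm_ring
      rw [key, ← Matrix.mulVec_mulVec, h4, onWires_swapMatrix, extend_swapOn hl.1]

theorem star_dotProduct_self_eq {α : Type} [Fintype α] (v : α → ℂ) :
    star v ⬝ᵥ v = ((∑ x, ‖v x‖ ^ 2 : ℝ) : ℂ) := by
  rw [dotProduct, Complex.ofReal_sum]
  refine Finset.sum_congr rfl fun x _ => ?_
  rw [Pi.star_apply, Complex.star_def, Complex.conj_mul', Complex.ofReal_pow]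

theorem sum_norm_sq_run_bellCircuit (v : Bits (PairWires n κ₁ κ₂) → ℂ) :
    ∑ x, ‖Circuit.run O (bellCircuit n κ₁ κ₂ Q κ) v x‖ ^ 2 = ∑ x, ‖v x‖ ^ 2 := by
  obtain ⟨M, h1, -, h3, -⟩ :=
    exists_matrix_run_bellStep (κ₁ := κ₁) (κ₂ := κ₂) O _ (List.nodup_finRange n)
  have h := star_dotProduct_self_eq (M *ᵥ v)
  rw [Matrix.star_mulVec, ← Matrix.dotProduct_mulVec, Matrix.mulVec_mulVec, h3, Matrix.one_mulVec,
    star_dotProduct_self_eq, Complex.ofReal_inj] at h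
  rw [bellCircuit, h1, h]

/-- Heisenberg picture: the mean sign in the final state is the expectation in `v` of the sign
observable conjugated by the circuit, which is the exchange of the system registers. -/
theorem sum_swapSign_run_bellCircuit (v : Bits (PairWires n κ₁ κ₂) → ℂ) :
    ((∑ x, ‖Circuit.run O (bellCircuit n κ₁ κ₂ Q κ) v x‖ ^ 2 * swapSign x : ℝ) : ℂ) =
      ∑ x, star (v x) * v (swapSystems x) := by
  obtain ⟨M, h1, -, -, h4⟩ :=
    exists_matrix_run_bellStep (κ₁ := κ₁) (κ₂ := κ₂) O _ (List.nodup_finRange n)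
  have hswap (x : Bits (PairWires n κ₁ κ₂)) : swapOn (List.finRange n) x = swapSystems x := by
    simp [swapOn, swapSystems]
  rw [bellCircuit, h1]
  calc _ = star (M *ᵥ v) ⬝ᵥ (signMatrix (List.finRange n) *ᵥ (M *ᵥ v)) := by
        rw [signMatrix_eq_diagonal, dotProduct, Complex.ofReal_sum]
        refine Finset.sum_congr rfl fun x _ => ?_
        rw [Matrix.mulVec_diagonal, Pi.star_apply, Complex.star_def, mul_left_comm,
          Complex.conj_mul', mul_comm, Complex.ofReal_mul, Complex.ofReal_pow]
        rfl
    _ = star v ⬝ᵥ ((Mᴴ * signMatrix (List.finRange n) * M) *ᵥ v) := by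
        rw [Matrix.star_mulVec, ← Matrix.dotProduct_mulVec, Matrix.mulVec_mulVec,
          Matrix.mulVec_mulVec, Matrix.mul_assoc]
    _ = _ := by
        rw [dotProduct]
        refine Finset.sum_congr rfl fun x _ => ?_
        rw [h4, hswap]
        rfl

end SwapTest

/-! ### Product states of two registers -/

/-- The state `a ⊗ b` of two registers. -/
def tensorKet {α β : Type} (a : Bits α → ℂ) (b : Bits β → ℂ) : Bits (α ⊕ β) → ℂ :=
  fun x => a (x ∘ Sum.inl) * b (x ∘ Sum.inr)

theorem zeroKet_eq_prod {α : Type} [Fintype α] (x : Bits α) : zeroKet α x = ∏ i, if x i = false then 1 else 0 := by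
  rw [Finset.prod_ite_zero, zeroKet]
  simp [funext_iff]

theorem zeroKet_sum {α β : Type} [Fintype α] [Fintype β] : zeroKet (α ⊕ β) = tensorKet (zeroKet α) (zeroKet β) := by
  ext x
  rw [tensorKet, zeroKet_eq_prod, zeroKet_eq_prod, zeroKet_eq_prod, Fintype.prod_sum_type]
  rfl

theorem zeroKet_eq_productState {ι β : Type} [Fintype ι] [Fintype β] {s : ℕ}
    (e : Fin s × β ≃ ι) : zeroKet ι = productState e fun _ => zeroKet β := by
  classical
  ext x
  rw [productState, zeroKet_eq_prod, ← e.prod_comp, Fintype.prod_prod_type]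
  refine Finset.prod_congr rfl fun i _ => ?_
  rw [zeroKet_eq_prod]
  rfl

section Tensor

variable {α β : Type}

variable [Fintype α] [DecidableEq α] [Fintype β] [DecidableEq β]

theorem sum_bits_sum {M : Type} [AddCommMonoid M] (F : Bits (α ⊕ β) → M) :
    ∑ x, F x = ∑ u, ∑ w, F (Sum.elim u w) := by
  rw [← (Equiv.sumArrowEquivProdArrow α β Bool).symm.sum_comp, Fintype.sum_prod_type]
  rfl

theorem onWires_inl_tensorKet (U : Matrix (Bits α) (Bits α) ℂ) (a : Bits α → ℂ)
    (b : Bits β → ℂ) :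
    onWires Function.Embedding.inl U *ᵥ tensorKet a b = tensorKet (U *ᵥ a) b := by
  ext x
  rw [onWires_mulVec, tensorKet, Matrix.mulVec, dotProduct, Finset.sum_mul]
  refine Finset.sum_congr rfl fun u _ => ?_
  have h1 : Function.extend (Function.Embedding.inl : α ↪ α ⊕ β) u x ∘ Sum.inl = u :=
    Function.extend_comp (Function.Embedding.inl : α ↪ α ⊕ β).injective _ _
  have h2 : Function.extend (Function.Embedding.inl : α ↪ α ⊕ β) u x ∘ Sum.inr = x ∘ Sum.inr := by
    ext b
    exact Function.extend_apply' _ _ _ (by simp)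
  rw [tensorKet, h1, h2, mul_assoc]
  rfl

theorem onWires_inr_tensorKet (U : Matrix (Bits β) (Bits β) ℂ) (a : Bits α → ℂ)
    (b : Bits β → ℂ) :
    onWires Function.Embedding.inr U *ᵥ tensorKet a b = tensorKet a (U *ᵥ b) := by
  ext x
  rw [onWires_mulVec, tensorKet, Matrix.mulVec, dotProduct, Finset.mul_sum]
  refine Finset.sum_congr rfl fun u _ => ?_
  have h1 : Function.extend (Function.Embedding.inr : β ↪ α ⊕ β) u x ∘ Sum.inr = u :=
    Function.extend_comp (Function.Embedding.inr : β ↪ α ⊕ β).injective _ _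
  have h2 : Function.extend (Function.Embedding.inr : β ↪ α ⊕ β) u x ∘ Sum.inl = x ∘ Sum.inl := by
    ext b
    exact Function.extend_apply' _ _ _ (by simp)
  rw [tensorKet, h1, h2, mul_left_comm]
  rfl

theorem sum_norm_sq_tensorKet (a : Bits α → ℂ) (b : Bits β → ℂ) :
    ∑ x, ‖tensorKet a b x‖ ^ 2 = (∑ u, ‖a u‖ ^ 2) * ∑ w, ‖b w‖ ^ 2 := by
  rw [sum_bits_sum, Finset.sum_mul_sum]
  refine Finset.sum_congr rfl fun u _ => Finset.sum_congr rfl fun w _ => ?_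
  rw [tensorKet, norm_mul, mul_pow]
  rfl

end Tensor

/-! ### The swap test on purifications -/

section Purification

variable {n : ℕ} {κ₁ κ₂ : Type} [Fintype κ₁] [DecidableEq κ₁] [Fintype κ₂] [DecidableEq κ₂]

/-- The vector `a` is a purification of the pure state `ψ`. -/
def IsPurification {κ : Type} [Fintype κ] [DecidableEq κ] (a : Bits (Fin n ⊕ κ) → ℂ)
    (ψ : QVec n) : Prop :=
  traceOutAncilla (Matrix.vecMulVec a (star a)) = pureState ψ

theorem IsPurification.apply {a : Bits (Fin n ⊕ κ₁) → ℂ} {ψ : QVec n} (h : IsPurification a ψ)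
    (x y : Bits (Fin n)) :
    ∑ z, a (Sum.elim x z) * star (a (Sum.elim y z)) = ψ x * star (ψ y) :=
  congr_fun (congr_fun h x) y

theorem IsPurification.sum_norm_sq {a : Bits (Fin n ⊕ κ₁) → ℂ} {ψ : QVec n}
    (h : IsPurification a ψ) (hψ : ‖ψ‖ = 1) : ∑ x, ‖a x‖ ^ 2 = 1 := by
  have h1 (x : Bits (Fin n)) : ∑ z, ‖a (Sum.elim x z)‖ ^ 2 = ‖ψ x‖ ^ 2 := by
    have := h.apply x x
    simp only [Complex.star_def, Complex.mul_conj'] at this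
    exact_mod_cast this
  rw [sum_bits_sum]
  simp only [h1]
  rw [← EuclideanSpace.norm_sq_eq, hψ, one_pow]

/-- The swap trick `tr (S (ρ ⊗ σ)) = tr (ρ σ)`. The exchange fixes the ancilla labels, so summing
over them produces entries of the two reduced states. -/
theorem sum_star_mul_swapSystems {a : Bits (Fin n ⊕ κ₁) → ℂ} {b : Bits (Fin n ⊕ κ₂) → ℂ}
    {ψ φ : QVec n} (ha : IsPurification a ψ) (hb : IsPurification b φ) :
    ∑ x, star (tensorKet a b x) * tensorKet a b (swapSystems x) =
      ((‖inner ℂ ψ φ‖ ^ 2 : ℝ) : ℂ) := by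
  rw [sum_bits_sum, sum_bits_sum]
  simp only [sum_bits_sum (α := Fin n) (β := κ₂)]
  have hterm (x : Bits (Fin n)) (z : Bits κ₁) (y : Bits (Fin n)) (w : Bits κ₂) :
      star (tensorKet a b (Sum.elim (Sum.elim x z) (Sum.elim y w))) *
        tensorKet a b (swapSystems (Sum.elim (Sum.elim x z) (Sum.elim y w))) =
      (a (Sum.elim y z) * star (a (Sum.elim x z))) *
        (b (Sum.elim x w) * star (b (Sum.elim y w))) := by
    have h1 : swapSystems (Sum.elim (Sum.elim x z) (Sum.elim y w)) =
        Sum.elim (Sum.elim y z) (Sum.elim x w) := by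
      ext i
      rcases i with (_ | _) | (_ | _) <;> rfl
    rw [h1, tensorKet, tensorKet]
    simp only [Sum.elim_comp_inl, Sum.elim_comp_inr, star_mul']
    ring
  calc _ = ∑ x, ∑ y, (∑ z, a (Sum.elim y z) * star (a (Sum.elim x z))) *
        ∑ w, b (Sum.elim x w) * star (b (Sum.elim y w)) := by
        refine Finset.sum_congr rfl fun x _ => ?_
        rw [Finset.sum_comm]
        refine Finset.sum_congr rfl fun y _ => ?_
        rw [Finset.sum_mul_sum]
        exact Finset.sum_congr rfl fun z _ => Finset.sum_congr rfl fun w _ => hterm x z y w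
    _ = (∑ x, star (ψ x) * φ x) * star (∑ y, star (ψ y) * φ y) := by
        rw [star_sum, Finset.sum_mul_sum]
        refine Finset.sum_congr rfl fun x _ => Finset.sum_congr rfl fun y _ => ?_
        rw [ha.apply, hb.apply, star_mul', star_star]
        ring
    _ = _ := by
        rw [← dotProduct_eq_inner, Complex.ofReal_pow, ← Complex.mul_conj']
        rfl

theorem swapTest_statistics {Q : Type} {κ : Q → Type} [∀ q, Fintype (κ q)]
    [∀ q, DecidableEq (κ q)] (O : ∀ q, Matrix.unitaryGroup (Bits (κ q)) ℂ)
    {a : Bits (Fin n ⊕ κ₁) → ℂ} {b : Bits (Fin n ⊕ κ₂) → ℂ} {ψ φ : QVec n}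
    (ha : IsPurification a ψ) (hb : IsPurification b φ) (hψ : ‖ψ‖ = 1) (hφ : ‖φ‖ = 1) :
    ∑ x, ‖Circuit.run O (bellCircuit n κ₁ κ₂ Q κ) (tensorKet a b) x‖ ^ 2 = 1 ∧
    ∑ x, ‖Circuit.run O (bellCircuit n κ₁ κ₂ Q κ) (tensorKet a b) x‖ ^ 2 * (1 - swapSign x) =
      traceDistance (pureState ψ) (pureState φ) ^ 2 := by
  have h1 : ∑ x, ‖Circuit.run O (bellCircuit n κ₁ κ₂ Q κ) (tensorKet a b) x‖ ^ 2 = 1 := by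
    rw [sum_norm_sq_run_bellCircuit, sum_norm_sq_tensorKet, ha.sum_norm_sq hψ, hb.sum_norm_sq hφ,
      one_mul]
  refine ⟨h1, ?_⟩
  have h2 := sum_swapSign_run_bellCircuit O (tensorKet a b)
  rw [sum_star_mul_swapSystems ha hb, Complex.ofReal_inj] at h2
  simp only [mul_sub, mul_one, Finset.sum_sub_distrib, h1, h2]
  rw [traceDistance_pureState ψ φ hψ hφ, Real.sq_sqrt]
  have h3 := norm_inner_le_norm (𝕜 := ℂ) ψ φ
  rw [hψ, hφ, one_mul] at h3
  have := pow_le_one₀ (n := 2) (norm_nonneg _) h3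
  linarith

/-- The estimate of the trace distance from the outcomes of `s` swap tests. -/
def estimate {ι : Type} {s : ℕ} (e : Fin s × PairWires n κ₁ κ₂ ≃ ι) (x : Bits ι) : ℝ :=
  Real.sqrt ((∑ i, (1 - swapSign (x ∘ blockEmb e i))) / s)

theorem probWithin_estimate {Q : Type} {κ : Q → Type} [∀ q, Fintype (κ q)]
    [∀ q, DecidableEq (κ q)] (O : ∀ q, Matrix.unitaryGroup (Bits (κ q)) ℂ)
    {a : Bits (Fin n ⊕ κ₁) → ℂ} {b : Bits (Fin n ⊕ κ₂) → ℂ} {ψ φ : QVec n}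
    (ha : IsPurification a ψ) (hb : IsPurification b φ) (hψ : ‖ψ‖ = 1) (hφ : ‖φ‖ = 1)
    {ι : Type} [Fintype ι] [DecidableEq ι] {s : ℕ} (e : Fin s × PairWires n κ₁ κ₂ ≃ ι)
    {ε η : ℝ} (hε : 0 < ε) (hη : 0 < η) (hs : 2 / (η * ε ^ 2) ≤ s) :
    1 - η ≤ probWithin
      (productState e fun _ => Circuit.run O (bellCircuit n κ₁ κ₂ Q κ) (tensorKet a b))
      (estimate e) (traceDistance (pureState ψ) (pureState φ)) ε := by
  obtain ⟨h1, h2⟩ := swapTest_statistics O ha hb hψ hφ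
  refine probWithin_productState e _ (fun y => 1 - swapSign y) h1 (fun y => ?_) ?_ h2 hε hη hs
  · linear_combination swapSign_sq y
  · rw [traceDistance_pureState ψ φ hψ hφ]
    exact Real.sqrt_nonneg _

end Purification

/-! ### The algorithms -/

/-- A path of length two would contain consecutive steps sharing a wire. -/
theorem depth_le_one {ι Q : Type} {κ : Q → Type} {c : Circuit ι Q κ}
    (h : c.Pairwise fun g g' => Disjoint g.wires g'.wires) : c.depth ≤ 1 := by
  refine csSup_le ⟨0, [], List.nil_sublist _, List.IsChain.nil, rfl⟩ ?_
  rintro d ⟨p, hp, hchain, rfl⟩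
  have hpair := h.sublist hp
  match p, hchain, hpair with
  | [], _, _ => simp
  | [_], _, _ => simp
  | a :: b :: p, hchain, hpair =>
    rw [List.isChain_cons_cons] at hchain
    have := (List.pairwise_cons.1 hpair).1 b (by simp)
    exact absurd (Set.disjoint_iff_inter_eq_empty.1 this) hchain.1.ne_empty

theorem depth_repeated_bellCircuit {n s : ℕ} {κ₁ κ₂ ι Q : Type} {κ : Q → Type}
    (e : Fin s × PairWires n κ₁ κ₂ ≃ ι) :
    Circuit.depth ((bellCircuit n κ₁ κ₂ Q κ).repeated e) ≤ 1 := by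
  refine depth_le_one ?_
  rw [Circuit.repeated, List.pairwise_flatMap]
  constructor
  · intro i _
    rw [bellCircuit, List.map_map, List.pairwise_map]
    refine (List.nodup_finRange n).imp fun {j k} hjk => ?_
    rw [Function.comp_apply, Function.comp_apply, Step.wires_map, Step.wires_map]
    exact (Set.disjoint_image_iff (blockEmb e i).injective).2 (disjoint_range_pairEmb hjk)
  · refine (List.nodup_finRange s).imp fun {i k} hik g hg g' hg' => ?_
    obtain ⟨g, -, rfl⟩ := List.mem_map.1 hg
    obtain ⟨g', -, rfl⟩ := List.mem_map.1 hg'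
    rw [Step.wires_map, Step.wires_map]
    exact (disjoint_range_blockEmb e hik).mono (Set.image_subset_range _ _)
      (Set.image_subset_range _ _)

theorem probWithin_zeroKet {ι : Type} [Fintype ι] [DecidableEq ι] {t ε : ℝ} (h : |0 - t| ≤ ε) :
    probWithin (zeroKet ι) (fun _ => 0) t ε = 1 := by
  simp only [probWithin, h, if_true]
  simp [zeroKet, apply_ite]

/-- Covers the cases where the guess 0 must be made at no cost: for `n = 0` the time bound is zero
because `log N = 0`, and for large `ε` the bounds fall below the cost of one repetition. The guess
is good because `T = 0` in dimension one and `T ≤ 1` always. -/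
theorem abs_zero_sub_traceDistance_le {n : ℕ} {ψ φ : QVec n} (hψ : ‖ψ‖ = 1) (hφ : ‖φ‖ = 1)
    {ε : ℝ} (hε : 0 < ε) (h : n = 0 ∨ 1 ≤ ε) :
    |0 - traceDistance (pureState ψ) (pureState φ)| ≤ ε := by
  rw [traceDistance_pureState ψ φ hψ hφ, zero_sub, abs_neg, abs_of_nonneg (Real.sqrt_nonneg _)]
  rcases h with rfl | h
  · have : ‖inner ℂ ψ φ‖ = 1 := by
      have h1 (χ : QVec 0) (hχ : ‖χ‖ = 1) (y : Bits (Fin 0)) : ‖χ y‖ ^ 2 = 1 := by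
        rw [← Fintype.sum_subsingleton (fun x => ‖χ x‖ ^ 2) y, ← EuclideanSpace.norm_sq_eq, hχ,
          one_pow]
      rw [PiLp.inner_apply, Fintype.sum_subsingleton _ fun _ => false,
        ← sq_eq_sq₀ (norm_nonneg _) zero_le_one, one_pow, RCLike.inner_apply, norm_mul, mul_pow,
        RCLike.norm_conj, h1 ψ hψ, h1 φ hφ, one_mul]
    rw [this]
    simpa using hε.le
  · refine le_trans ?_ h
    rw [Real.sqrt_le_one]
    have := sq_nonneg ‖inner ℂ ψ φ‖
    linarith

/-- Rounding up costs at most `1`, which is at most `1 / ε²` because `ε < 1`. -/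
theorem nat_ceil_repetitions_le {ε η : ℝ} (hε : 0 < ε) (hε1 : ε < 1) (hη : 0 < η) :
    (⌈2 / (η * ε ^ 2)⌉₊ : ℝ) ≤ (2 / η + 1) * (1 / ε ^ 2) := by
  refine (Nat.ceil_lt_add_one (by positivity)).le.trans ?_
  have : 1 ≤ 1 / ε ^ 2 := by
    rw [le_div_iff₀ (by positivity), one_mul]
    exact pow_le_one₀ hε.le hε1.le
  have h2 : 2 / (η * ε ^ 2) = 2 / η * (1 / ε ^ 2) := by field_simp
  rw [h2, add_mul, one_mul]
  linarith

/-- The constant in the complexity bounds for failure probability `η`. -/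
def complexityConst (η : ℝ) : ℝ := 3 * (2 / η + 1) / Real.log 2

/-- Since `log 2 < 1`, the constant chosen to absorb `log N = n log 2` also serves the bounds that
have no factor `log N`. -/
theorem le_complexityConst {η : ℝ} (hη : 0 < η) : 3 * (2 / η + 1) ≤ complexityConst η := by
  rw [complexityConst, le_div_iff₀ (Real.log_pos one_lt_two)]
  have := Real.log_two_lt_d9
  have h : 0 < 3 * (2 / η + 1) := by positivity
  nlinarith

theorem complexityConst_mul_log (η x : ℝ) (n : ℕ) :
    complexityConst η * (x * Real.log ((2 : ℝ) ^ n)) = 3 * (2 / η + 1) * x * n := by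
  have := (Real.log_pos one_lt_two).ne'
  rw [complexityConst, Real.log_pow]
  field_simp

theorem log_two_pow_nonneg (n : ℕ) : 0 ≤ Real.log ((2 : ℝ) ^ n) :=
  Real.log_nonneg (one_le_pow₀ one_le_two)

/-- One block of the algorithm with purified access. -/
def querySwapCircuit (n : ℕ) (anc : Fin 2 → ℕ) :
    Circuit (PairWires n (Fin (anc 0)) (Fin (anc 1))) (Fin 2) (fun i => Fin n ⊕ Fin (anc i)) :=
  Step.query 0 false Function.Embedding.inl :: Step.query 1 false Function.Embedding.inr ::
    bellCircuit n _ _ _ _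

theorem run_querySwapCircuit {n : ℕ} {anc : Fin 2 → ℕ}
    (U : ∀ i, Matrix.unitaryGroup (Bits (Fin n ⊕ Fin (anc i))) ℂ) :
    (querySwapCircuit n anc).run U (zeroKet _) =
      Circuit.run U (bellCircuit n _ _ _ _)
        (tensorKet ((U 0).1 *ᵥ zeroKet _) ((U 1).1 *ᵥ zeroKet _)) := by
  rw [zeroKet_sum, ← onWires_inr_tensorKet, ← onWires_inl_tensorKet]
  rfl

theorem queryCount_querySwapCircuit (n : ℕ) (anc : Fin 2 → ℕ) :
    (querySwapCircuit n anc).queryCount = 2 := by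
  have : List.countP Step.isQuery (bellCircuit n (Fin (anc 0)) (Fin (anc 1)) (Fin 2)
      fun i => Fin n ⊕ Fin (anc i)) = 0 := by
    simp [bellCircuit, bellStep, Step.isQuery]
  simp [querySwapCircuit, Circuit.queryCount, List.countP_cons, Step.isQuery, this]

theorem size_bellCircuit (n : ℕ) (κ₁ κ₂ Q : Type) (κ : Q → Type) :
    (bellCircuit n κ₁ κ₂ Q κ).size = n := by
  simp [bellCircuit, Circuit.size]

theorem size_querySwapCircuit (n : ℕ) (anc : Fin 2 → ℕ) :
    (querySwapCircuit n anc).size = n + 2 := by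
  exact congr_arg (· + 2) (size_bellCircuit n (Fin (anc 0)) (Fin (anc 1)) (Fin 2)
    fun i => Fin n ⊕ Fin (anc i))

theorem purifiedAccess (η : ℝ) (hη : 0 < η) : ∃ C : ℝ, 0 < C ∧
    ∀ (n : ℕ) (anc : Fin 2 → ℕ), (∀ i, anc i ≤ n) → ∀ ε : ℝ, 0 < ε →
      ∃ A : QueryAlgorithm n anc,
        (A.queryComplexity : ℝ) ≤ C * (1 / ε ^ 2) ∧
        (A.timeComplexity : ℝ) ≤ C * (1 / ε ^ 2 * Real.log ((2 : ℝ) ^ n)) ∧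
        ∀ (ψ φ : QVec n), ‖ψ‖ = 1 → ‖φ‖ = 1 →
        ∀ U : ∀ i, Matrix.unitaryGroup (Bits (Fin n ⊕ Fin (anc i))) ℂ,
          PreparesPurification (U 0) (pureState ψ) →
          PreparesPurification (U 1) (pureState φ) →
          1 - η ≤ A.successProb U (traceDistance (pureState ψ) (pureState φ)) ε := by
  have hC : 0 < complexityConst η := lt_of_lt_of_le (by positivity) (le_complexityConst hη)
  refine ⟨complexityConst η, hC, fun n anc _ ε hε => ?_⟩
  by_cases htriv : n = 0 ∨ 1 ≤ ε
  · refine ⟨⟨0, [], fun _ => 0⟩, ?_, ?_, fun ψ φ hψ hφ U _ _ => ?_⟩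
    · simp only [QueryAlgorithm.queryComplexity, Circuit.queryCount, List.countP_nil, Nat.cast_zero]
      positivity
    · simp only [QueryAlgorithm.timeComplexity, Circuit.size, List.length_nil, Nat.cast_zero]
      have := log_two_pow_nonneg n
      positivity
    · have : QueryAlgorithm.successProb ⟨0, [], fun _ => 0⟩ U
          (traceDistance (pureState ψ) (pureState φ)) ε = 1 :=
        probWithin_zeroKet (abs_zero_sub_traceDistance_le hψ hφ hε htriv)
      rw [this]
      linarith
  · push Not at htriv
    obtain ⟨hn, hε1⟩ := htriv
    have hn1 : (1 : ℝ) ≤ n := by exact_mod_cast Nat.one_le_iff_ne_zero.2 hn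
    set s := ⌈2 / (η * ε ^ 2)⌉₊ with hs
    have hsle := nat_ceil_repetitions_le hε hε1 hη
    rw [← hs] at hsle
    let e := Fintype.equivFin (Fin s × PairWires n (Fin (anc 0)) (Fin (anc 1)))
    refine ⟨⟨_, (querySwapCircuit n anc).repeated e, estimate e⟩, ?_, ?_,
      fun ψ φ hψ hφ U hU₀ hU₁ => ?_⟩
    · rw [QueryAlgorithm.queryComplexity, Circuit.queryCount_repeated, queryCount_querySwapCircuit]
      push_cast
      have h1 := mul_le_mul_of_nonneg_right (le_complexityConst hη)
        (show 0 ≤ 1 / ε ^ 2 by positivity)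
      have h2 : 0 ≤ (2 / η + 1) * (1 / ε ^ 2) := by positivity
      linarith
    · rw [QueryAlgorithm.timeComplexity, Circuit.size_repeated, size_querySwapCircuit,
        complexityConst_mul_log]
      push_cast
      -- Each repetition costs two queries and `n` gates, at most `3n` as `n ≥ 1`; this is the
      -- factor 3 in `complexityConst`.
      have h1 : (s : ℝ) * (n + 2) ≤ s * (3 * n) :=
        mul_le_mul_of_nonneg_left (by linarith) (Nat.cast_nonneg _)
      have h2 := mul_le_mul_of_nonneg_right hsle (show (0 : ℝ) ≤ 3 * n by linarith)
      linarith
    · rw [QueryAlgorithm.successProb]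
      dsimp only
      rw [zeroKet_eq_productState e, run_repeated, run_querySwapCircuit]
      -- `PreparesPurification` unfolds to `IsPurification` of the vector prepared by the oracle.
      exact probWithin_estimate U hU₀ hU₁ hψ hφ e hε hη (Nat.le_ceil _)

/-- The wires of `s` pairs of copies, grouped into pairs. -/
def sampleEquiv (n s : ℕ) : Fin s × PairWires n Empty Empty ≃ SampleWires n s s 0 where
  toFun
    | (i, Sum.inl (Sum.inl j)) => Sum.inl (Sum.inl (i, j))
    | (i, Sum.inr (Sum.inl j)) => Sum.inl (Sum.inr (i, j))
  invFun
    | Sum.inl (Sum.inl (i, j)) => (i, Sum.inl (Sum.inl j))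
    | Sum.inl (Sum.inr (i, j)) => (i, Sum.inr (Sum.inl j))
  left_inv := by rintro ⟨i, (j | j) | (j | j)⟩ <;> first | rfl | exact j.elim
  right_inv := by rintro ((⟨i, j⟩ | ⟨i, j⟩) | j) <;> first | rfl | exact j.elim0

/-- A state of the system, as a state of the system with an empty ancilla. -/
def withoutAncilla {n : ℕ} (ψ : QVec n) : Bits (Fin n ⊕ Empty) → ℂ := fun x => ψ (x ∘ Sum.inl)

/-- Over an empty ancilla the partial trace has one term; this lets sample access reuse the analysis
of purifications. -/
theorem isPurification_withoutAncilla {n : ℕ} (ψ : QVec n) :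
    IsPurification (withoutAncilla ψ) ψ := by
  ext x y
  rw [traceOutAncilla, Fintype.sum_unique]
  rfl

theorem copies_eq_productState {n s : ℕ} (ψ φ : QVec n) :
    copies s s 0 ψ φ = productState (sampleEquiv n s)
      fun _ => tensorKet (withoutAncilla ψ) (withoutAncilla φ) := by
  ext x
  have h : zeroKet (Fin 0) (fun j => x (Sum.inr j)) = 1 := by simp [zeroKet_eq_prod]
  rw [copies, h, mul_one, ← Finset.prod_mul_distrib]
  rfl

theorem sampleAccess (η : ℝ) (hη : 0 < η) : ∃ C : ℝ, 0 < C ∧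
    ∀ (n : ℕ) (ε : ℝ), 0 < ε →
      ∃ A : SampleAlgorithm n,
        (A.sampleComplexity : ℝ) ≤ C * (1 / ε ^ 4) ∧
        (A.timeComplexity : ℝ) ≤ C * (1 / ε ^ 4 * Real.log ((2 : ℝ) ^ n)) ∧
        (A.depthComplexity : ℝ) ≤ C ∧
        ∀ (ψ φ : QVec n), ‖ψ‖ = 1 → ‖φ‖ = 1 →
          1 - η ≤ A.successProb ψ φ (traceDistance (pureState ψ) (pureState φ)) ε := by
  have hCle := le_complexityConst hη
  have hC3 : 3 ≤ complexityConst η := by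
    have : 0 < 2 / η := by positivity
    linarith
  have hC : 0 < complexityConst η := by linarith
  refine ⟨complexityConst η, hC, fun n ε hε => ?_⟩
  by_cases htriv : n = 0 ∨ 1 ≤ ε
  · refine ⟨⟨0, 0, 0, [], fun _ => 0⟩, ?_, ?_, ?_, fun ψ φ hψ hφ => ?_⟩
    · simp only [SampleAlgorithm.sampleComplexity, add_zero, Nat.cast_zero]
      positivity
    · simp only [SampleAlgorithm.timeComplexity, SampleAlgorithm.sampleComplexity, Circuit.size,
        List.length_nil, add_zero, Nat.cast_zero]
      have := log_two_pow_nonneg n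
      positivity
    · have : Circuit.depth ([] : Circuit (SampleWires n 0 0 0) Empty fun _ => Empty) ≤ 1 :=
        depth_le_one List.Pairwise.nil
      have h : (SampleAlgorithm.depthComplexity (n := n) ⟨0, 0, 0, [], fun _ => 0⟩ : ℝ) ≤ 1 := by
        exact_mod_cast this
      linarith
    -- With no copies and no workspace there are no wires, and both sides are empty products.
    · have h0 : copies 0 0 0 ψ φ = zeroKet (SampleWires n 0 0 0) := by
        ext x
        rw [zeroKet_eq_prod]
        simp [copies, zeroKet_eq_prod]
      have : SampleAlgorithm.successProb ⟨0, 0, 0, [], fun _ => 0⟩ ψ φ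
          (traceDistance (pureState ψ) (pureState φ)) ε = 1 := by
        rw [SampleAlgorithm.successProb]
        dsimp only
        rw [h0]
        exact probWithin_zeroKet (abs_zero_sub_traceDistance_le hψ hφ hε htriv)
      rw [this]
      linarith
  · push Not at htriv
    obtain ⟨hn, hε1⟩ := htriv
    have hn1 : (1 : ℝ) ≤ n := by exact_mod_cast Nat.one_le_iff_ne_zero.2 hn
    set s := ⌈2 / (η * ε ^ 2)⌉₊ with hs
    -- The number of repetitions is still of order `1 / ε²`; since `ε < 1`, this is weakened to `1 /
    -- ε⁴`.
    have hsle : (s : ℝ) ≤ (2 / η + 1) * (1 / ε ^ 4) := by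
      refine (nat_ceil_repetitions_le hε hε1 hη).trans ?_
      refine mul_le_mul_of_nonneg_left ?_ (by positivity)
      exact one_div_le_one_div_of_le (by positivity)
        (pow_le_pow_of_le_one hε.le hε1.le (by norm_num))
    refine ⟨⟨s, s, 0, (bellCircuit n _ _ _ _).repeated (sampleEquiv n s),
      estimate (sampleEquiv n s)⟩, ?_, ?_, ?_, fun ψ φ hψ hφ => ?_⟩
    · rw [SampleAlgorithm.sampleComplexity]
      push_cast
      have h1 := mul_le_mul_of_nonneg_right hCle (show 0 ≤ 1 / ε ^ 4 by positivity)
      have h2 : 0 ≤ (2 / η + 1) * (1 / ε ^ 4) := by positivity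
      linarith
    · rw [SampleAlgorithm.timeComplexity, SampleAlgorithm.sampleComplexity, Circuit.size_repeated,
        size_bellCircuit, complexityConst_mul_log]
      push_cast
      have h1 : (s : ℝ) * (2 + n) ≤ s * (3 * n) :=
        mul_le_mul_of_nonneg_left (by linarith) (Nat.cast_nonneg _)
      have h2 := mul_le_mul_of_nonneg_right hsle (show (0 : ℝ) ≤ 3 * n by linarith)
      linarith
    · have : (Circuit.depth ((bellCircuit n Empty Empty Empty fun _ => Empty).repeated
          (sampleEquiv n s)) : ℝ) ≤ 1 := by
        exact_mod_cast depth_repeated_bellCircuit (sampleEquiv n s)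
      rw [SampleAlgorithm.depthComplexity]
      linarith
    · rw [SampleAlgorithm.successProb]
      dsimp only
      rw [copies_eq_productState, run_repeated]
      exact probWithin_estimate _ (isPurification_withoutAncilla ψ)
        (isPurification_withoutAncilla φ) hψ hφ (sampleEquiv n s) hε hη (Nat.le_ceil _)

end TraceDist

end

theorem mainTheorem6 :
    -- the trace distance of two pure states, in terms of their overlap
    (∀ (n : ℕ) (ψ φ : TraceDist.QVec n), ‖ψ‖ = 1 → ‖φ‖ = 1 →
      TraceDist.traceDistance (TraceDist.pureState ψ) (TraceDist.pureState φ) =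
        Real.sqrt (1 - ‖inner ℂ ψ φ‖ ^ 2)) ∧
    -- purified access
    (∀ η : ℝ, 0 < η → ∃ C : ℝ, 0 < C ∧
      ∀ (n : ℕ) (anc : Fin 2 → ℕ), (∀ i, anc i ≤ n) → ∀ ε : ℝ, 0 < ε →
        ∃ A : TraceDist.QueryAlgorithm n anc,
          (A.queryComplexity : ℝ) ≤ C * (1 / ε ^ 2) ∧
          (A.timeComplexity : ℝ) ≤ C * (1 / ε ^ 2 * Real.log ((2 : ℝ) ^ n)) ∧
          ∀ (ψ φ : TraceDist.QVec n), ‖ψ‖ = 1 → ‖φ‖ = 1 →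
          ∀ U : ∀ i, Matrix.unitaryGroup (TraceDist.Bits (Fin n ⊕ Fin (anc i))) ℂ,
            TraceDist.PreparesPurification (U 0) (TraceDist.pureState ψ) →
            TraceDist.PreparesPurification (U 1) (TraceDist.pureState φ) →
            1 - η ≤ A.successProb U
              (TraceDist.traceDistance (TraceDist.pureState ψ) (TraceDist.pureState φ)) ε) ∧
    -- sample access
    (∀ η : ℝ, 0 < η → ∃ C : ℝ, 0 < C ∧
      ∀ (n : ℕ) (ε : ℝ), 0 < ε →
        ∃ A : TraceDist.SampleAlgorithm n,
          (A.sampleComplexity : ℝ) ≤ C * (1 / ε ^ 4) ∧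
          (A.timeComplexity : ℝ) ≤ C * (1 / ε ^ 4 * Real.log ((2 : ℝ) ^ n)) ∧
          (A.depthComplexity : ℝ) ≤ C ∧
          ∀ (ψ φ : TraceDist.QVec n), ‖ψ‖ = 1 → ‖φ‖ = 1 →
            1 - η ≤ A.successProb ψ φ
              (TraceDist.traceDistance (TraceDist.pureState ψ) (TraceDist.pureState φ)) ε) :=
  ⟨fun _ => TraceDist.traceDistance_pureState, TraceDist.purifiedAccess, TraceDist.sampleAccess⟩
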